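/- Let $m\ge 2$, $n=2^m-2$, and let $\mathbb F$ be the field with two elements. Let $L$ be the $(n+2)$-dimensional Lie algebra over $\mathbb F$ with basis $v(0),\dots,v(n-1),w,x$ and the bilinear product given by $$v(i)\cdot v(j)=\binom{j+1}{n-i}\,v(i\oplus j),\qquad v(i)\cdot w=w\cdot v(i)=v(i+1)\ (0\le i\le n-2),\qquad v(n-1)\cdot w=w\cdot v(n-1)=w,$$ $$v(i)\cdot x=x\cdot v(i)=0,\qquad w\cdot x=x\cdot w=v(0),\qquad w\cdot w=x\cdot x=0,$$ where $i\oplus j\in\{0,\dots,n-2\}$ and $i\oplus j\equiv i+j \pmod{n-1}$. Let $W$ be the ideal of $L$ spanned by $v(0),\dots,v(n-1),w$. Let $\mathcal A$ be either the set of all nonempty subsets of $\mathbb N$ or the set of all nonempty finite subsets of $\mathbb N$. For $A\in\mathcal A$ let $W_A=\{z_A : z\in W\}$ be a copy of the vector space $W$, and let $W^*=\bigoplus_{A\in\mathcal A}W_A$, with the bilinear product given by $z_A\cdot t_B=(z\cdot t)_{A\cup B}$ if $A\cap B=\emptyset$ and $z_A\cdot t_B=0$ otherwise. Let $L^*=W^*\oplus\mathbb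 F x$ be the semidirect product given by the action $z_A\cdot x=(z\cdot x)_A$; it is a Lie algebra over $\mathbb F$. For $y\in L^*$ let $\mathrm{ad}(y)$ be the linear operator on $L^*$ given by multiplication by $y$. For $y=x$, $y=v(i)_A$ and $y=w_A$ one has $\mathrm{ad}(y)^2=0$, so that $1+\mathrm{ad}(y)\in \mathrm{GL}(L^*)$ is its own inverse. Let $G\le \mathrm{GL}(L^*)$ be the subgroup generated by $1+\mathrm{ad}(x)$ and all $1+\mathrm{ad}(v(i)_A)$ and $1+\mathrm{ad}(w_A)$, for $0\le i\le n-1$ and $A\in\mathcal A$. Then, for every $m\ge 2$ and each of the two choices of $\mathcal A$: 1. $L^*$ is infinite-dimensional and locally nilpotent (every finitely generated subalgebra is nilpotent). 2. The elements $1+\mathrm{ad}(x)$, $1+\mathrm{ad}(w_A)$ for $A\in\mathcal A$, and $1+\mathrm{ad}(v(i)_A)$ for $0\le i\le n-1$ and $A\in\mathcal A$, $A\ne\mathbb N$, have order exactly $2$. 3. $a=1+\mathrm{ad}(x)$ is a left $3$-Engel element of $G$, that is, $[[[g,a],a],a]=1$ for all $g\in G$, where $[g,h]=g^{-1}h^{-1}gh$.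 4. The normal closure of $1+\mathrm{ad}(x)$ in $G$ is not nilpotent. 5. $G$ is a $2$-group that is locally finite and locally nilpotent (every finitely generated subgroup is finite and nilpotent). -/

import Mathlib

namespace EngelTwo

theorem choose_compl (m k r : ℕ) (hk : k < 2 ^ m) (hr : r < 2 ^ m) :
    ((2 ^ m - 1 - k).choose r : ZMod 2) = ((k + r).choose r : ZMod 2) := by
  induction k generalizing r with
  | zero =>
    induction r with
    | zero => simp
    | succ r ih =>
      have h1 : ((2 ^ m).choose (r + 1) : ZMod 2) = 0 := by
        rw [ZMod.natCast_eq_zero_iff]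
        exact Nat.prime_two.dvd_choose_pow (by omega) (by omega)
      have h2 : (2 ^ m).choose (r + 1) = (2 ^ m - 1).choose r + (2 ^ m - 1).choose (r + 1) := by
        conv_lhs => rw [show 2 ^ m = (2 ^ m - 1) + 1 by omega]
        rw [Nat.choose_succ_succ]
      have h3 := ih (by omega)
      rw [h2] at h1
      push_cast at h1
      simp only [Nat.sub_zero, Nat.zero_add, Nat.choose_self] at h3 ⊢
      rw [h3] at h1
      rw [← CharTwo.add_eq_zero, add_comm]
      simpa using h1
  | succ k ih =>
    induction r with
    | zero => simp
    | succ r ihr =>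
      have h1 := ih (r + 1) (by omega) hr
      have h2 := ihr (by omega)
      have h3 : (2 ^ m - 1 - k).choose (r + 1) =
          (2 ^ m - 1 - (k + 1)).choose r + (2 ^ m - 1 - (k + 1)).choose (r + 1) := by
        rw [show 2 ^ m - 1 - k = (2 ^ m - 1 - (k + 1)) + 1 by omega, Nat.choose_succ_succ]
      have h4 : (k + 1 + (r + 1)).choose (r + 1) =
          (k + 1 + r).choose r + (k + (r + 1)).choose (r + 1) := by
        rw [show k + 1 + (r + 1) = (k + 1 + r) + 1 by omega, Nat.choose_succ_succ,
          show k + 1 + r = k + (r + 1) by omega]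
      rw [h3] at h1
      rw [h4]
      push_cast at h1 ⊢
      rw [h2] at h1
      rw [← h1, ← add_assoc, CharTwo.add_self_eq_zero, zero_add]

theorem choose_even (m p q : ℕ) (hp : p < 2 ^ m) (hq : q < 2 ^ m) (h : 2 ^ m ≤ p + q) :
    ((p + q).choose p : ZMod 2) = 0 := by
  rw [add_comm, ← choose_compl m q p hq hp, Nat.choose_eq_zero_of_lt (by omega), Nat.cast_zero]

theorem choose_fac (a b : ℕ) :
    (a + b).choose a * a.factorial * b.factorial = (a + b).factorial := by
  have := Nat.add_choose_mul_factorial_mul_factorial b a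
  rw [add_comm b a] at this
  rw [← this]; ring

theorem choose_cyc (p q r : ℕ) (h1 : 1 ≤ p + q) (h2 : 1 ≤ q + r) (h3 : 1 ≤ r + p) :
    (q + r).choose q * (p + (q + r - 1)).choose p + (r + p).choose r * (q + (r + p - 1)).choose q
      + (p + q).choose p * (r + (p + q - 1)).choose r
      = 2 * ((p + q + r).choose p * (q + r).choose q) := by
  have key : ∀ a b c : ℕ, 1 ≤ b + c →
      (b + c).choose b * (a + (b + c - 1)).choose a * (a.factorial * b.factorial * c.factorial)
        = (b + c) * (a + b + c - 1).factorial := by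
    intro a b c h
    obtain ⟨s, hs⟩ : ∃ s, b + c = s + 1 := ⟨b + c - 1, by omega⟩
    have e1 := choose_fac b c
    have e2 := choose_fac a s
    rw [show a + b + c - 1 = a + s by omega, ← e2]
    rw [hs, Nat.factorial_succ] at e1
    rw [hs, Nat.add_sub_cancel]
    rw [← Nat.mul_left_inj (Nat.factorial_ne_zero s)]
    calc _ = ((s + 1).choose b * b.factorial * c.factorial) *
          ((a + s).choose a * a.factorial * s.factorial) := by ring
      _ = _ := by rw [e1]; ring
  have pos : 0 < p.factorial * q.factorial * r.factorial := by positivity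
  apply Nat.eq_of_mul_eq_mul_right pos
  have k1 := key p q r h2
  have k2 := key q r p h3
  have k3 := key r p q h1
  rw [show q + r + p - 1 = p + q + r - 1 by omega] at k2
  rw [show r + p + q - 1 = p + q + r - 1 by omega] at k3
  have e1 := choose_fac q r
  have e2 := choose_fac p (q + r)
  rw [← add_assoc] at e2
  obtain ⟨s, hs⟩ : ∃ s, p + q + r = s + 1 := ⟨p + q + r - 1, by omega⟩
  calc _ = ((q + r) + (r + p) + (p + q)) * (p + q + r - 1).factorial := by
        linear_combination k1 + k2 + k3
    _ = 2 * (p + q + r).factorial := by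
        rw [hs, Nat.factorial_succ, Nat.add_sub_cancel, ← hs]; ring
    _ = _ := by rw [← e2, ← e1]; ring

/-! ### The Lie algebra `L` -/

/-- The parameter `n = 2 ^ m - 2`. -/
def dim (m : ℕ) : ℕ := 2 ^ m - 2

/-- The index set of the basis `v(0), …, v(n-1), w, x` of `L`. -/
inductive Idx (m : ℕ) : Type
  | v (i : Fin (dim m)) : Idx m
  | w : Idx m
  | x : Idx m

/-- The vector space `L` over the field with two elements, with basis indexed by `Idx m`. -/
def L (m : ℕ) : Type := Idx m →₀ ZMod 2

noncomputable instance (m : ℕ) : AddCommGroup (L m) :=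
  inferInstanceAs (AddCommGroup (Idx m →₀ ZMod 2))

noncomputable instance (m : ℕ) : Module (ZMod 2) (L m) :=
  inferInstanceAs (Module (ZMod 2) (Idx m →₀ ZMod 2))

/-- The basis vector of `L` with a given index. -/
noncomputable def L.basis {m : ℕ} (b : Idx m) : L m := Finsupp.single b 1

/-- The basis vector `v(i)` for `i < n` (and `0` for all other `i`, which are never used). -/
noncomputable def L.v (m : ℕ) (i : ℕ) : L m := if h : i < dim m then L.basis (.v ⟨i, h⟩) else 0

/-- The basis vector `w`. -/
noncomputable def L.w (m : ℕ) : L m := L.basis .w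

/-- The basis vector `x`. -/
noncomputable def L.x (m : ℕ) : L m := L.basis .x

/-- The residue of `i + j` modulo `n - 1`, in `{0, …, n - 2}`. -/
def oplus (m i j : ℕ) : ℕ := (i + j) % (dim m - 1)

/-- The multiplication table of `L`. -/
noncomputable def L.table {m : ℕ} : Idx m → Idx m → L m
  | .v i, .v j => (((j : ℕ) + 1).choose (dim m - i) : ZMod 2) • L.v m (oplus m i j)
  | .v i, .w => if (i : ℕ) + 1 < dim m then L.v m (i + 1) else L.w m
  | .w, .v i => if (i : ℕ) + 1 < dim m then L.v m (i + 1) else L.w m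
  | .v _, .x => 0
  | .x, .v _ => 0
  | .w, .x => L.v m 0
  | .x, .w => L.v m 0
  | .w, .w => 0
  | .x, .x => 0

/-- The linear map on `L` with prescribed values on the basis. -/
noncomputable def L.extend {m : ℕ} {M : Type*} [AddCommGroup M] [Module (ZMod 2) M]
    (F : Idx m → M) : L m →ₗ[ZMod 2] M := Finsupp.lift M (ZMod 2) (Idx m) F

theorem L.extend_basis {m : ℕ} {M : Type*} [AddCommGroup M] [Module (ZMod 2) M]
    (F : Idx m → M) (b : Idx m) : L.extend F (L.basis b) = F b := by
  refine (Finsupp.lift_apply _ _ _ _ _).trans ?_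
  refine (Finsupp.sum_single_index (h := fun a r => r • F a) (zero_smul _ _)).trans ?_
  exact one_smul _ _

/-- The bilinear extension of the multiplication table to `L`. -/
noncomputable def L.mul (m : ℕ) : L m →ₗ[ZMod 2] L m →ₗ[ZMod 2] L m :=
  L.extend fun b => L.extend (L.table b)

theorem L.mul_basis {m : ℕ} (b c : Idx m) : L.mul m (L.basis b) (L.basis c) = L.table b c := by
  rw [L.mul, L.extend_basis, L.extend_basis]

theorem L.induction {m : ℕ} {P : L m → Prop} (h0 : P 0) (hadd : ∀ f g, P f → P g → P (f + g))
    (hb : ∀ b, P (L.basis b)) (f : L m) : P f := by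
  refine Finsupp.induction_linear (motive := P) f h0 (fun f g => hadd f g) ?_
  intro b c
  have h : ∀ c : ZMod 2, c = 0 ∨ c = 1 := by decide
  rcases h c with rfl | rfl
  · rw [Finsupp.single_zero]; exact h0
  · exact hb b

/-- The basis vectors in the order `w, v(n-1), …, v(0), x` (auxiliary, for the Jacobi identity). -/
noncomputable def L.e (m : ℕ) (p : ℕ) : L m :=
  if p = 0 then L.w m else if p ≤ dim m then L.v m (dim m - p)
  else if p = dim m + 1 then L.x m else 0

theorem L.e_of_gt {m p : ℕ} (h : dim m + 1 < p) : L.e m p = 0 := by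
  rw [L.e, if_neg (by omega), if_neg (by omega), if_neg (by omega)]

theorem two_pow_eq {m : ℕ} (hm : 1 ≤ m) : 2 ^ m = dim m + 2 := by
  have : 2 ^ 1 ≤ 2 ^ m := Nat.pow_le_pow_right (by norm_num) hm
  unfold dim; omega

/-- The position of a basis vector in the order `w, v(n-1), …, v(0), x`. -/
def pos {m : ℕ} : Idx m → ℕ
  | .v i => dim m - i
  | .w => 0
  | .x => dim m + 1

theorem pos_le {m : ℕ} (b : Idx m) : pos b ≤ dim m + 1 := by
  cases b <;> simp [pos]; omega

theorem L.e_zero (m : ℕ) : L.e m 0 = L.w m := by simp [L.e]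

theorem L.e_mid {m p i : ℕ} (hp : p ≠ 0) (h : p + i = dim m) : L.e m p = L.v m i := by
  rw [L.e, if_neg hp, if_pos (by omega)]; congr 1; omega

theorem L.e_top (m : ℕ) : L.e m (dim m + 1) = L.x m := by
  rw [L.e, if_neg (by omega), if_neg (by omega), if_pos rfl]

theorem L.v_fin {m : ℕ} (i : Fin (dim m)) : L.v m i = L.basis (.v i) := by
  rw [L.v, dif_pos i.2]

theorem L.e_pos {m : ℕ} (b : Idx m) : L.e m (pos b) = L.basis b := by
  cases b with
  | v i => have := i.2; rw [← L.v_fin]; exact L.e_mid (by simp [pos]; omega) (by simp [pos])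
  | w => exact L.e_zero m
  | x => exact L.e_top m

theorem table_zero {m : ℕ} (h : dim m = 0) (b c : Idx m) : L.table b c = 0 := by
  have : L.v m 0 = 0 := by rw [L.v, dif_neg (by omega)]
  cases b with
  | v i => exact absurd i.2 (by omega)
  | w => cases c with
    | v i => exact absurd i.2 (by omega)
    | w => rfl
    | x => exact this
  | x => cases c with
    | v i => exact absurd i.2 (by omega)
    | w => exact this
    | x => rfl

theorem table_eq {m : ℕ} (h2 : 2 ^ m = dim m + 2) (hn : dim m ≠ 0) (b c : Idx m)
    (hbc : pos b + pos c ≠ 0) :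
    L.table b c = ((pos b + pos c).choose (pos b) : ZMod 2) • L.e m (pos b + pos c - 1) := by
  cases b with
  | v i =>
    have hi := i.2
    cases c with
    | v j =>
      have hj := j.2
      simp only [L.table, pos]
      have hc := choose_compl m (dim m - j) (dim m - i) (by omega) (by omega)
      rw [show 2 ^ m - 1 - (dim m - j) = (j : ℕ) + 1 by omega,
        Nat.add_comm (dim m - (j : ℕ))] at hc
      rw [hc]
      by_cases h0 : ((dim m - (i : ℕ) + (dim m - j)).choose (dim m - i) : ZMod 2) = 0
      · rw [h0, zero_smul, zero_smul]
      · have h1 : dim m - (i : ℕ) + (dim m - j) < 2 ^ m := by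
          by_contra h
          exact h0 (choose_even m _ _ (by omega) (by omega) (by omega))
        congr 1
        symm
        apply L.e_mid (by omega)
        unfold oplus
        by_cases h3 : (i : ℕ) + j - (dim m - 1) < dim m - 1
        · rw [Nat.mod_eq_sub_mod (by omega), Nat.mod_eq_of_lt h3]; omega
        · exfalso
          apply h0
          rw [show dim m - (i : ℕ) = 1 by omega, show dim m - (j : ℕ) = 1 by omega]
          decide
    | w =>
      simp only [L.table, pos]
      simp only [Nat.add_zero, Nat.choose_self, Nat.cast_one, one_smul]
      split_ifs with h
      · exact (L.e_mid (by omega) (by omega)).symm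
      · rw [show dim m - (i : ℕ) - 1 = 0 by omega, L.e_zero]
    | x =>
      simp only [L.table, pos]
      rw [choose_even m _ _ (by omega) (by omega) (by omega), zero_smul]
  | w =>
    cases c with
    | v i =>
      have hi := i.2
      simp only [L.table, pos]
      simp only [Nat.zero_add, Nat.choose_zero_right, Nat.cast_one, one_smul]
      split_ifs with h
      · exact (L.e_mid (by omega) (by omega)).symm
      · rw [show dim m - (i : ℕ) - 1 = 0 by omega, L.e_zero]
    | w => exact absurd rfl hbc
    | x =>
      simp only [L.table, pos]
      simp only [Nat.zero_add, Nat.choose_zero_right, Nat.cast_one, one_smul]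
      exact (L.e_mid (by omega) (by omega)).symm
  | x =>
    cases c with
    | v i =>
      have hi := i.2
      simp only [L.table, pos]
      rw [choose_even m _ _ (by omega) (by omega) (by omega), zero_smul]
    | w =>
      simp only [L.table, pos]
      simp only [Nat.add_zero, Nat.choose_self, Nat.cast_one, one_smul]
      exact (L.e_mid (by omega) (by omega)).symm
    | x =>
      simp only [L.table, pos]
      rw [choose_even m _ _ (by omega) (by omega) (by omega), zero_smul]

theorem table_comm {m : ℕ} (b c : Idx m) : L.table b c = L.table c b := by
  by_cases hn : dim m = 0
  · rw [table_zero hn, table_zero hn]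
  have h2 : 2 ^ m = dim m + 2 := by unfold dim at *; omega
  by_cases hbc : pos b + pos c = 0
  · have hb : L.e m (pos b) = L.e m (pos c) := by congr 1; omega
    have key : b = c := by
      cases b <;> cases c <;> simp [pos] at hbc ⊢ <;> omega
    rw [key]
  · rw [table_eq h2 hn b c hbc, table_eq h2 hn c b (by omega), Nat.add_comm (pos c),
      Nat.choose_symm_add]

theorem table_self {m : ℕ} (b : Idx m) : L.table b b = 0 := by
  by_cases hn : dim m = 0
  · rw [table_zero hn]
  have h2 : 2 ^ m = dim m + 2 := by unfold dim at *; omega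
  by_cases hb : pos b = 0
  · cases b with
    | v i => exact absurd hb (by simp [pos]; omega)
    | w => rfl
    | x => rfl
  · rw [table_eq h2 hn b b (by omega), ← two_mul]
    have := (ZMod.natCast_eq_zero_iff _ 2).2
      (Nat.two_dvd_centralBinom_of_one_le (n := pos b) (by omega))
    rw [Nat.centralBinom_eq_two_mul_choose] at this
    rw [this, zero_smul]

theorem L.char_two {m : ℕ} (f : L m) : f + f = 0 := by
  rw [← two_smul (ZMod 2) f, show (2 : ZMod 2) = 0 from rfl, zero_smul]

theorem L.mul_comm {m : ℕ} (f g : L m) : L.mul m f g = L.mul m g f := by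
  induction f using L.induction with
  | h0 => simp
  | hadd f f' h h' => simp [h, h']
  | hb b =>
    induction g using L.induction with
    | h0 => simp
    | hadd g g' h h' => simp [h, h']
    | hb c => rw [L.mul_basis, L.mul_basis, table_comm]

theorem L.mul_self {m : ℕ} (f : L m) : L.mul m f f = 0 := by
  induction f using L.induction with
  | h0 => simp
  | hadd f g hf hg =>
    simp only [map_add, LinearMap.add_apply, hf, hg, L.mul_comm g f, zero_add, add_zero]
    exact L.char_two _
  | hb b => rw [L.mul_basis, table_self]

theorem L.mul_e {m : ℕ} (h2 : 2 ^ m = dim m + 2) (hn : dim m ≠ 0) {p q : ℕ}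
    (hp : p ≤ dim m + 1) (hq : q ≤ dim m + 1) (h : p + q ≠ 0) :
    L.mul m (L.e m p) (L.e m q) = ((p + q).choose p : ZMod 2) • L.e m (p + q - 1) := by
  have surj : ∀ p ≤ dim m + 1, ∃ b : Idx m, pos b = p := by
    intro p hp
    by_cases h0 : p = 0
    · exact ⟨.w, h0.symm⟩
    by_cases h1 : p = dim m + 1
    · exact ⟨.x, h1.symm⟩
    exact ⟨.v ⟨dim m - p, by omega⟩, by simp [pos]; omega⟩
  obtain ⟨b, rfl⟩ := surj p hp
  obtain ⟨c, rfl⟩ := surj q hq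
  rw [L.e_pos, L.e_pos, L.mul_basis, table_eq h2 hn b c h]

theorem L.mul_mul_e {m : ℕ} (h2 : 2 ^ m = dim m + 2) (hn : dim m ≠ 0) {p q r : ℕ}
    (hp : p ≤ dim m + 1) (hq : q ≤ dim m + 1) (hr : r ≤ dim m + 1)
    (h : q + r ≠ 0) (h' : p + (q + r - 1) ≠ 0) :
    L.mul m (L.e m p) (L.mul m (L.e m q) (L.e m r)) =
      (((q + r).choose q * (p + (q + r - 1)).choose p : ℕ) : ZMod 2) • L.e m (p + q + r - 2) := by
  rw [L.mul_e h2 hn hq hr h, map_smul, Nat.cast_mul]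
  by_cases h3 : q + r < 2 ^ m
  · rw [L.mul_e h2 hn hp (by omega) h', smul_smul]
    congr 2
    omega
  · rw [choose_even m q r (by omega) (by omega) (by omega), zero_mul, zero_smul, zero_smul]

theorem L.jacobi_basis {m : ℕ} (b c d : Idx m) :
    L.mul m (L.basis b) (L.mul m (L.basis c) (L.basis d))
      + L.mul m (L.basis c) (L.mul m (L.basis d) (L.basis b))
      + L.mul m (L.basis d) (L.mul m (L.basis b) (L.basis c)) = 0 := by
  have same : ∀ f g : L m,
      L.mul m f (L.mul m f g) + L.mul m f (L.mul m g f) + L.mul m g (L.mul m f f) = 0 := by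
    intro f g
    rw [L.mul_self, map_zero, add_zero, L.mul_comm g f, L.char_two]
  by_cases hn : dim m = 0
  · simp [L.mul_basis, table_zero hn]
  have h2 : 2 ^ m = dim m + 2 := by unfold dim at *; omega
  have hb := pos_le b
  have hc := pos_le c
  have hd := pos_le d
  rw [← L.e_pos b, ← L.e_pos c, ← L.e_pos d]
  generalize pos b = p at *
  generalize pos c = q at *
  generalize pos d = r at *
  by_cases h1 : p + q = 0
  · obtain rfl : p = q := by omega
    exact same _ _
  by_cases h3 : q + r = 0
  · obtain rfl : q = r := by omega
    have := same (L.e m q) (L.e m p)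
    rw [add_comm, ← add_assoc] at this
    exact this
  by_cases h4 : r + p = 0
  · obtain rfl : p = r := by omega
    have := same (L.e m p) (L.e m q)
    rw [add_assoc, add_comm, add_right_comm] at this
    rw [add_assoc, add_comm]
    exact (by abel : _ = _).trans this
  rw [L.mul_mul_e h2 hn hb hc hd h3 (by omega), L.mul_mul_e h2 hn hc hd hb h4 (by omega),
    L.mul_mul_e h2 hn hd hb hc h1 (by omega), show q + r + p - 2 = p + q + r - 2 by omega,
    show r + p + q - 2 = p + q + r - 2 by omega, ← add_smul, ← add_smul, ← Nat.cast_add,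
    ← Nat.cast_add, choose_cyc p q r (by omega) (by omega) (by omega), Nat.cast_mul]
  rw [show ((2 : ℕ) : ZMod 2) = 0 from rfl, zero_mul, zero_smul]

theorem L.jacobi {m : ℕ} (f g h : L m) :
    L.mul m f (L.mul m g h) + L.mul m g (L.mul m h f) + L.mul m h (L.mul m f g) = 0 := by
  have hadd : ∀ a b c a' b' c' : L m, a + b + c = 0 → a' + b' + c' = 0 →
      (a + a') + (b + b') + (c + c') = 0 := by
    intro a b c a' b' c' h h'
    rw [show (a + a') + (b + b') + (c + c') = (a + b + c) + (a' + b' + c') by abel, h, h', add_zero]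
  induction f using L.induction with
  | h0 => simp
  | hadd f f' hf hf' =>
    simp only [map_add, LinearMap.add_apply]; exact hadd _ _ _ _ _ _ hf hf'
  | hb b =>
    induction g using L.induction with
    | h0 => simp
    | hadd f f' hf hf' =>
      simp only [map_add, LinearMap.add_apply]; exact hadd _ _ _ _ _ _ hf hf'
    | hb c =>
      induction h using L.induction with
      | h0 => simp
      | hadd f f' hf hf' =>
        simp only [map_add, LinearMap.add_apply]; exact hadd _ _ _ _ _ _ hf hf'
      | hb d => exact L.jacobi_basis b c d

/-- The bracket of `L` is the bilinear extension of the multiplication table. -/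
noncomputable instance (m : ℕ) : Bracket (L m) (L m) := ⟨fun f g => L.mul m f g⟩

theorem L.lie_def {m : ℕ} (f g : L m) : ⁅f, g⁆ = L.mul m f g := rfl

/-- `L` is a Lie algebra over the field with two elements. -/
noncomputable instance (m : ℕ) : LieRing (L m) where
  add_lie f g h := by simp [L.lie_def]
  lie_add f g h := by simp [L.lie_def]
  lie_self f := L.mul_self f
  leibniz_lie f g h := by
    have := L.jacobi f g h
    simp only [L.lie_def]
    rw [L.mul_comm h f, L.mul_comm h (L.mul m f g)] at this
    rw [← sub_eq_zero, ← this, sub_eq_add_neg]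
    have hneg : ∀ a : L m, -a = a := fun a => neg_eq_of_add_eq_zero_left (L.char_two a)
    rw [hneg]; abel

noncomputable instance (m : ℕ) : LieAlgebra (ZMod 2) (L m) where
  lie_smul t f g := by simp [L.lie_def]

theorem L.lie_basis {m : ℕ} (b c : Idx m) : ⁅L.basis b, L.basis c⁆ = L.table b c :=
  L.mul_basis b c

/-- The ideal `W` of `L`, spanned by `v(0), …, v(n-1)` and `w`. -/
noncomputable def W (m : ℕ) : LieIdeal (ZMod 2) (L m) where
  toSubmodule := Submodule.span (ZMod 2) (Set.range (fun i : Fin (dim m) => L.v m i) ∪ {L.w m})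
  lie_mem := by
    intro f g hg
    clear hg
    have hv : ∀ i, L.v m i ∈
        Submodule.span (ZMod 2) (Set.range (fun i : Fin (dim m) => L.v m i) ∪ {L.w m}) := by
      intro i
      by_cases h : i < dim m
      · exact Submodule.subset_span (Or.inl ⟨⟨i, h⟩, rfl⟩)
      · rw [L.v, dif_neg h]; exact Submodule.zero_mem _
    have hw : L.w m ∈
        Submodule.span (ZMod 2) (Set.range (fun i : Fin (dim m) => L.v m i) ∪ {L.w m}) :=
      Submodule.subset_span (Or.inr rfl)
    change ⁅f, g⁆ ∈ Submodule.span (ZMod 2) _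
    induction f using L.induction with
    | h0 => rw [zero_lie]; exact Submodule.zero_mem _
    | hadd f f' h h' => rw [add_lie]; exact Submodule.add_mem _ h h'
    | hb b =>
      induction g using L.induction with
      | h0 => rw [lie_zero]; exact Submodule.zero_mem _
      | hadd f f' h h' => rw [lie_add]; exact Submodule.add_mem _ h h'
      | hb c =>
        rw [L.lie_basis]
        cases b <;> cases c <;> simp only [L.table]
        all_goals first
          | exact Submodule.smul_mem _ _ (hv _)
          | exact hv _
          | exact Submodule.zero_mem _
          | (split_ifs; exacts [hv _, hw])

/-- `v(i)` as an element of `W`. -/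
noncomputable def W.v (m : ℕ) (i : Fin (dim m)) : W m :=
  ⟨L.v m i, Submodule.subset_span (Or.inl ⟨i, rfl⟩)⟩

/-- `w` as an element of `W`. -/
noncomputable def W.w (m : ℕ) : W m := ⟨L.w m, Submodule.subset_span (Or.inr rfl)⟩

/-! ### The Lie algebra `L*` -/

/-- A family of nonempty subsets of `ℕ` that is closed under disjoint unions (the index sets of the
copies of `W`; the families used are `SetFamily.all` and `SetFamily.finite`). -/
structure SetFamily where
  sets : Set (Set ℕ)
  nonempty : ∀ A ∈ sets, A.Nonempty
  union_mem : ∀ A ∈ sets, ∀ B ∈ sets, Disjoint A B → A ∪ B ∈ sets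

/-- The family of all nonempty subsets of `ℕ`. -/
def SetFamily.all : SetFamily where
  sets := {A | A.Nonempty}
  nonempty _ h := h
  union_mem _ h _ _ _ := h.inl

/-- The family of all nonempty finite subsets of `ℕ`. -/
def SetFamily.finite : SetFamily where
  sets := {A | A.Nonempty ∧ A.Finite}
  nonempty _ h := h.1
  union_mem _ h _ h' _ := ⟨h.1.inl, h.2.union h'.2⟩

/-- The vector space `W*`: the direct sum of copies `W_A` of `W`, for `A` in the family.
The element `z_A` is `Finsupp.single A z`. -/
abbrev WStar (m : ℕ) (𝒜 : SetFamily) : Type := 𝒜.sets →₀ W m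

open Classical in
/-- The map `z ↦ z_{A ⊔ B}` into `W*`: here `A ⊔ B` is the union if `A` and `B` are disjoint, and
empty otherwise, where `z_∅ = 0`. -/
noncomputable def WStar.place {m : ℕ} {𝒜 : SetFamily} (A B : 𝒜.sets) :
    W m →ₗ[ZMod 2] WStar m 𝒜 :=
  if h : Disjoint (A : Set ℕ) (B : Set ℕ) then
    Finsupp.lsingle ⟨(A : Set ℕ) ∪ B, 𝒜.union_mem A A.2 B B.2 h⟩
  else 0

/-- The bilinear product of `W*`, given by `z_A · t_B = (z · t)_{A ⊔ B}`. -/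
noncomputable def WStar.mul (m : ℕ) (𝒜 : SetFamily) :
    WStar m 𝒜 →ₗ[ZMod 2] WStar m 𝒜 →ₗ[ZMod 2] WStar m 𝒜 :=
  Finsupp.lsum (ZMod 2) fun A => LinearMap.flip <| Finsupp.lsum (ZMod 2) fun B =>
    ((LieModule.toEnd (ZMod 2) (W m) (W m) : W m →ₗ[ZMod 2] W m →ₗ[ZMod 2] W m).compr₂
      (WStar.place A B)).flip

theorem WStar.mul_single {m : ℕ} {𝒜 : SetFamily} (A B : 𝒜.sets) (z t : W m) :
    WStar.mul m 𝒜 (Finsupp.single A z) (Finsupp.single B t) = WStar.place A B ⁅z, t⁆ := by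
  simp [WStar.mul]

/-- The action of `x` on `W*`, given by `x · z_A = (x · z)_A`. -/
noncomputable def WStar.actX (m : ℕ) (𝒜 : SetFamily) : WStar m 𝒜 →ₗ[ZMod 2] WStar m 𝒜 :=
  Finsupp.mapRange.linearMap (LieModule.toEnd (ZMod 2) (L m) (W m) (L.x m))

theorem WStar.actX_single {m : ℕ} {𝒜 : SetFamily} (A : 𝒜.sets) (z : W m) :
    WStar.actX m 𝒜 (Finsupp.single A z) = Finsupp.single A ⁅L.x m, z⁆ := by
  simp [WStar.actX]

theorem place_disj {m : ℕ} {𝒜 : SetFamily} {A B : 𝒜.sets} (h : Disjoint (A : Set ℕ) (B : Set ℕ))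
    (z : W m) : WStar.place A B z =
      Finsupp.single ⟨(A : Set ℕ) ∪ B, 𝒜.union_mem A A.2 B B.2 h⟩ z := by
  simp [WStar.place, h]

theorem place_not {m : ℕ} {𝒜 : SetFamily} {A B : 𝒜.sets} (h : ¬ Disjoint (A : Set ℕ) (B : Set ℕ))
    (z : W m) : WStar.place A B z = 0 := by
  simp [WStar.place, h]

theorem place_comm {m : ℕ} {𝒜 : SetFamily} (A B : 𝒜.sets) (z : W m) :
    WStar.place A B z = WStar.place B A z := by
  by_cases h : Disjoint (A : Set ℕ) (B : Set ℕ)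
  · rw [place_disj h, place_disj h.symm]
    congr 1
    exact Subtype.ext (Set.union_comm _ _)
  · rw [place_not h, place_not (fun h' => h h'.symm)]

theorem not_disjoint_self {𝒜 : SetFamily} (A : 𝒜.sets) : ¬ Disjoint (A : Set ℕ) (A : Set ℕ) := by
  intro h
  exact (𝒜.nonempty A A.2).ne_empty (disjoint_self.1 h)

open Classical in
theorem WStar.mul_mul_single {m : ℕ} {𝒜 : SetFamily} (A B C : 𝒜.sets) (z t u : W m) :
    WStar.mul m 𝒜 (Finsupp.single A z) (WStar.mul m 𝒜 (Finsupp.single B t) (Finsupp.single C u))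
      = if h : Disjoint (B : Set ℕ) (C : Set ℕ) ∧ Disjoint (A : Set ℕ) ((B : Set ℕ) ∪ C) then
          Finsupp.single ⟨(A : Set ℕ) ∪ ((B : Set ℕ) ∪ C), 𝒜.union_mem A A.2 _
            (𝒜.union_mem B B.2 C C.2 h.1) h.2⟩ ⁅z, ⁅t, u⁆⁆
        else 0 := by
  rw [WStar.mul_single]
  by_cases h : Disjoint (B : Set ℕ) (C : Set ℕ)
  · rw [place_disj h, WStar.mul_single]
    by_cases h' : Disjoint (A : Set ℕ) ((B : Set ℕ) ∪ C)
    · rw [dif_pos ⟨h, h'⟩, place_disj h']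
    · rw [dif_neg (fun hh => h' hh.2), place_not h']
  · rw [dif_neg (fun hh => h hh.1), place_not h, map_zero]

theorem WStar.mul_anti {m : ℕ} {𝒜 : SetFamily} (f g : WStar m 𝒜) :
    WStar.mul m 𝒜 f g = - WStar.mul m 𝒜 g f := by
  induction f using Finsupp.induction_linear with
  | zero => simp
  | add f f' h h' => simp only [map_add, LinearMap.add_apply, h, h']; abel
  | single A z =>
    induction g using Finsupp.induction_linear with
    | zero => simp
    | add g g' h h' => simp only [map_add, LinearMap.add_apply, h, h']; abel
    | single B t =>
      rw [WStar.mul_single, WStar.mul_single, place_comm, ← lie_skew, map_neg]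

theorem WStar.mul_self {m : ℕ} {𝒜 : SetFamily} (f : WStar m 𝒜) : WStar.mul m 𝒜 f f = 0 := by
  induction f using Finsupp.induction_linear with
  | zero => simp
  | add f g h h' =>
    simp only [map_add, LinearMap.add_apply, h, h', WStar.mul_anti g f]; abel
  | single A z => rw [WStar.mul_single, lie_self, map_zero]

theorem WStar.leibniz {m : ℕ} {𝒜 : SetFamily} (f g h : WStar m 𝒜) :
    WStar.mul m 𝒜 f (WStar.mul m 𝒜 g h) =
      WStar.mul m 𝒜 (WStar.mul m 𝒜 f g) h + WStar.mul m 𝒜 g (WStar.mul m 𝒜 f h) := by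
  induction f using Finsupp.induction_linear with
  | zero => simp
  | add f f' e e' => simp only [map_add, LinearMap.add_apply, e, e']; abel
  | single A z =>
    induction g using Finsupp.induction_linear with
    | zero => simp
    | add f f' e e' => simp only [map_add, LinearMap.add_apply, e, e']; abel
    | single B t =>
      induction h using Finsupp.induction_linear with
      | zero => simp
      | add f f' e e' => simp only [map_add, e, e']; abel
      | single C u =>
        rw [WStar.mul_anti (WStar.mul m 𝒜 _ _), WStar.mul_mul_single, WStar.mul_mul_single,
          WStar.mul_mul_single]
        by_cases h : Disjoint (A : Set ℕ) B ∧ Disjoint (A : Set ℕ) C ∧ Disjoint (B : Set ℕ) C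
        · obtain ⟨h1, h2, h3⟩ := h
          rw [dif_pos ⟨h3, Set.disjoint_union_right.2 ⟨h1, h2⟩⟩,
            dif_pos ⟨h1, Set.disjoint_union_right.2 ⟨h2.symm, h3.symm⟩⟩,
            dif_pos ⟨h2, Set.disjoint_union_right.2 ⟨h1.symm, h3⟩⟩]
          have e1 : (C : Set ℕ) ∪ ((A : Set ℕ) ∪ B) = (A : Set ℕ) ∪ ((B : Set ℕ) ∪ C) := by
            rw [Set.union_comm, Set.union_assoc]
          have e2 : (B : Set ℕ) ∪ ((A : Set ℕ) ∪ C) = (A : Set ℕ) ∪ ((B : Set ℕ) ∪ C) :=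
            Set.union_left_comm _ _ _
          simp only [e1, e2]
          rw [← Finsupp.single_neg, ← Finsupp.single_add]
          congr 1
          rw [lie_skew, leibniz_lie]
        · rw [dif_neg, dif_neg, dif_neg]
          · simp
          · rintro ⟨h1, h2⟩
            rw [Set.disjoint_union_right] at h2
            exact h ⟨h2.1.symm, h1, h2.2⟩
          · rintro ⟨h1, h2⟩
            rw [Set.disjoint_union_right] at h2
            exact h ⟨h1, h2.1.symm, h2.2.symm⟩
          · rintro ⟨h1, h2⟩
            rw [Set.disjoint_union_right] at h2
            exact h ⟨h2.1, h2.2, h1⟩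

theorem WStar.actX_mul {m : ℕ} {𝒜 : SetFamily} (f g : WStar m 𝒜) :
    WStar.actX m 𝒜 (WStar.mul m 𝒜 f g) =
      WStar.mul m 𝒜 (WStar.actX m 𝒜 f) g + WStar.mul m 𝒜 f (WStar.actX m 𝒜 g) := by
  induction f using Finsupp.induction_linear with
  | zero => simp
  | add f f' e e' => simp only [map_add, LinearMap.add_apply, e, e']; abel
  | single A z =>
    induction g using Finsupp.induction_linear with
    | zero => simp
    | add f f' e e' => simp only [map_add, e, e']; abel
    | single B t =>
      rw [WStar.actX_single, WStar.actX_single, WStar.mul_single, WStar.mul_single,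
        WStar.mul_single, ← map_add]
      have hx : ⁅L.x m, ⁅z, t⁆⁆ = ⁅⁅L.x m, z⁆, t⁆ + ⁅z, ⁅L.x m, t⁆⁆ := by
        apply Subtype.ext
        exact leibniz_lie (L.x m) (z : L m) (t : L m)
      rw [← hx]
      by_cases h : Disjoint (A : Set ℕ) (B : Set ℕ)
      · rw [place_disj h, place_disj h, WStar.actX_single]
      · rw [place_not h, place_not h, map_zero]

/-- The vector space `L* = W* ⊕ 𝔽 x`; the pair `(f, a)` is the element `f + a x`. -/
def LStar (m : ℕ) (𝒜 : SetFamily) : Type := WStar m 𝒜 × ZMod 2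

noncomputable instance (m : ℕ) (𝒜 : SetFamily) : AddCommGroup (LStar m 𝒜) :=
  inferInstanceAs (AddCommGroup (WStar m 𝒜 × ZMod 2))

noncomputable instance (m : ℕ) (𝒜 : SetFamily) : Module (ZMod 2) (LStar m 𝒜) :=
  inferInstanceAs (Module (ZMod 2) (WStar m 𝒜 × ZMod 2))

/-- The product of the semidirect product `L* = W* ⊕ 𝔽 x`. -/
noncomputable instance (m : ℕ) (𝒜 : SetFamily) : Bracket (LStar m 𝒜) (LStar m 𝒜) :=
  ⟨fun y z => (WStar.mul m 𝒜 y.1 z.1 + y.2 • WStar.actX m 𝒜 z.1 - z.2 • WStar.actX m 𝒜 y.1, 0)⟩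

theorem LStar.ext {m : ℕ} {𝒜 : SetFamily} {y z : LStar m 𝒜} (h : y.1 = z.1) (h' : y.2 = z.2) :
    y = z := Prod.ext h h'

theorem LStar.lie_fst {m : ℕ} {𝒜 : SetFamily} (y z : LStar m 𝒜) : (⁅y, z⁆ : LStar m 𝒜).1 =
    WStar.mul m 𝒜 y.1 z.1 + y.2 • WStar.actX m 𝒜 z.1 - z.2 • WStar.actX m 𝒜 y.1 := rfl

theorem LStar.lie_snd {m : ℕ} {𝒜 : SetFamily} (y z : LStar m 𝒜) : (⁅y, z⁆ : LStar m 𝒜).2 = 0 := rfl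

theorem LStar.add_fst {m : ℕ} {𝒜 : SetFamily} (y z : LStar m 𝒜) : (y + z).1 = y.1 + z.1 := rfl

theorem LStar.add_snd {m : ℕ} {𝒜 : SetFamily} (y z : LStar m 𝒜) : (y + z).2 = y.2 + z.2 := rfl

theorem LStar.smul_fst {m : ℕ} {𝒜 : SetFamily} (t : ZMod 2) (y : LStar m 𝒜) :
    (t • y).1 = t • y.1 := rfl

theorem LStar.smul_snd {m : ℕ} {𝒜 : SetFamily} (t : ZMod 2) (y : LStar m 𝒜) :
    (t • y).2 = t * y.2 := rfl

/-- `L*` is a Lie algebra over the field with two elements. -/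
noncomputable instance (m : ℕ) (𝒜 : SetFamily) : LieRing (LStar m 𝒜) where
  add_lie f g h := by
    refine LStar.ext ?_ (by simp [LStar.lie_snd, LStar.add_snd])
    simp only [LStar.lie_fst, LStar.add_fst, LStar.add_snd, map_add, LinearMap.add_apply]
    module
  lie_add f g h := by
    refine LStar.ext ?_ (by simp [LStar.lie_snd, LStar.add_snd])
    simp only [LStar.lie_fst, LStar.add_fst, LStar.add_snd, map_add]
    module
  lie_self f := by
    refine LStar.ext ?_ rfl
    rw [LStar.lie_fst, WStar.mul_self, zero_add, sub_self]
    rfl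
  leibniz_lie f g h := by
    refine LStar.ext ?_ (by simp [LStar.lie_snd, LStar.add_snd])
    simp only [LStar.lie_fst, LStar.lie_snd, LStar.add_fst, map_add, map_sub, map_smul,
      LinearMap.add_apply, LinearMap.sub_apply, LinearMap.smul_apply, WStar.actX_mul]
    rw [WStar.leibniz f.1 g.1 h.1, WStar.mul_anti g.1 (WStar.actX m 𝒜 f.1)]
    module

noncomputable instance (m : ℕ) (𝒜 : SetFamily) : LieAlgebra (ZMod 2) (LStar m 𝒜) where
  lie_smul t f g := by
    refine LStar.ext ?_ (by simp [LStar.lie_snd, LStar.smul_snd])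
    simp only [LStar.lie_fst, LStar.smul_fst, LStar.smul_snd, map_smul]
    module

/-- The element `x` of `L*`. -/
noncomputable def LStar.x (m : ℕ) (𝒜 : SetFamily) : LStar m 𝒜 := ((0 : WStar m 𝒜), (1 : ZMod 2))

/-- The element `z_A` of `L*`, for `z` in `W` and `A` in the family. -/
noncomputable def LStar.copy {m : ℕ} {𝒜 : SetFamily} (z : W m) (A : 𝒜.sets) : LStar m 𝒜 :=
  ((Finsupp.single A z : WStar m 𝒜), (0 : ZMod 2))

/-! ### The group `G` -/

theorem lie_x_lie_x {m : ℕ} (z : L m) : ⁅L.x m, ⁅L.x m, z⁆⁆ = 0 := by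
  have hv : ∀ i, ⁅L.x m, L.v m i⁆ = 0 := by
    intro i
    by_cases h : i < dim m
    · rw [L.v, dif_pos h, L.x, L.lie_basis]; rfl
    · rw [L.v, dif_neg h, lie_zero]
  induction z using L.induction with
  | h0 => simp
  | hadd f g hf hg => rw [lie_add, lie_add, hf, hg, add_zero]
  | hb b =>
    rw [L.x, L.lie_basis, ← L.x]
    cases b with
    | v i => exact lie_zero _
    | w => exact hv 0
    | x => exact lie_zero _

theorem ad_x_sq (m : ℕ) (𝒜 : SetFamily) : LieAlgebra.ad (ZMod 2) (LStar m 𝒜) (LStar.x m 𝒜) *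
    LieAlgebra.ad (ZMod 2) (LStar m 𝒜) (LStar.x m 𝒜) = 0 := by
  ext1 y
  have h : ∀ f : WStar m 𝒜, WStar.actX m 𝒜 (WStar.actX m 𝒜 f) = 0 := by
    intro f
    induction f using Finsupp.induction_linear with
    | zero => simp
    | add f f' e e' => simp only [map_add, e, e', add_zero]
    | single A z =>
      rw [WStar.actX_single, WStar.actX_single, show ⁅L.x m, ⁅L.x m, z⁆⁆ = 0 from
        Subtype.ext (lie_x_lie_x (z : L m)), Finsupp.single_zero]
  simp only [Module.End.mul_apply, LieAlgebra.ad_apply, LinearMap.zero_apply]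
  refine LStar.ext ?_ rfl
  rw [LStar.lie_fst, LStar.lie_fst]
  simp [LStar.x, h]
  rfl

theorem ad_copy_sq {m : ℕ} {𝒜 : SetFamily} (z : W m) (A : 𝒜.sets) :
    LieAlgebra.ad (ZMod 2) (LStar m 𝒜) (LStar.copy z A) *
      LieAlgebra.ad (ZMod 2) (LStar m 𝒜) (LStar.copy z A) = 0 := by
  ext1 y
  have h : ∀ f : WStar m 𝒜, WStar.mul m 𝒜 (Finsupp.single A z)
      (WStar.mul m 𝒜 (Finsupp.single A z) f) = 0 := by
    intro f
    induction f using Finsupp.induction_linear with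
    | zero => simp
    | add f f' e e' => simp only [map_add, e, e', add_zero]
    | single B t =>
      rw [WStar.mul_mul_single, dif_neg]
      rintro ⟨-, h2⟩
      exact not_disjoint_self A (Set.disjoint_union_right.1 h2).1
  have h' : ∀ t : W m, WStar.mul m 𝒜 (Finsupp.single A z) (Finsupp.single A t) = 0 := by
    intro t
    rw [WStar.mul_single, place_not (not_disjoint_self A)]
  simp only [Module.End.mul_apply, LieAlgebra.ad_apply, LinearMap.zero_apply]
  refine LStar.ext ?_ rfl
  rw [LStar.lie_fst, LStar.lie_fst, LStar.lie_snd]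
  simp [LStar.copy, h, h', WStar.actX_single]
  rfl

/-- The invertible operator `1 + ad(y)` on `L*`, for `y` with `ad(y)² = 0`; it is its own inverse,
as the characteristic is two. -/
noncomputable def oneAddAd {m : ℕ} {𝒜 : SetFamily} (y : LStar m 𝒜)
    (hy : LieAlgebra.ad (ZMod 2) (LStar m 𝒜) y * LieAlgebra.ad (ZMod 2) (LStar m 𝒜) y = 0) :
    LinearMap.GeneralLinearGroup (ZMod 2) (LStar m 𝒜) :=
  have h : (1 + LieAlgebra.ad (ZMod 2) (LStar m 𝒜) y) *
      (1 + LieAlgebra.ad (ZMod 2) (LStar m 𝒜) y) = 1 := by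
    rw [mul_add, add_mul, add_mul, hy, one_mul, one_mul, mul_one, add_zero, add_assoc, ← two_smul (ZMod 2),
      show (2 : ZMod 2) = 0 from rfl, zero_smul, add_zero]
  ⟨1 + LieAlgebra.ad (ZMod 2) (LStar m 𝒜) y, 1 + LieAlgebra.ad (ZMod 2) (LStar m 𝒜) y, h, h⟩

/-- The operator `1 + ad(x)`. -/
noncomputable def genX (m : ℕ) (𝒜 : SetFamily) :
    LinearMap.GeneralLinearGroup (ZMod 2) (LStar m 𝒜) :=
  oneAddAd (LStar.x m 𝒜) (ad_x_sq m 𝒜)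

/-- The operator `1 + ad(v(i)_A)`. -/
noncomputable def genV {m : ℕ} {𝒜 : SetFamily} (i : Fin (dim m)) (A : 𝒜.sets) :
    LinearMap.GeneralLinearGroup (ZMod 2) (LStar m 𝒜) :=
  oneAddAd (LStar.copy (W.v m i) A) (ad_copy_sq _ A)

/-- The operator `1 + ad(w_A)`. -/
noncomputable def genW {m : ℕ} {𝒜 : SetFamily} (A : 𝒜.sets) :
    LinearMap.GeneralLinearGroup (ZMod 2) (LStar m 𝒜) :=
  oneAddAd (LStar.copy (W.w m) A) (ad_copy_sq _ A)

/-- The group `G` generated by all `1 + ad(x)`, `1 + ad(v(i)_A)` and `1 + ad(w_A)`. -/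
noncomputable def G (m : ℕ) (𝒜 : SetFamily) :
    Subgroup (LinearMap.GeneralLinearGroup (ZMod 2) (LStar m 𝒜)) :=
  Subgroup.closure ({genX m 𝒜} ∪ Set.range (fun p : Fin (dim m) × 𝒜.sets => genV p.1 p.2) ∪
    Set.range (fun A : 𝒜.sets => genW A))

/-- The element `1 + ad(x)` of `G`. -/
noncomputable def G.a (m : ℕ) (𝒜 : SetFamily) : G m 𝒜 :=
  ⟨genX m 𝒜, Subgroup.subset_closure (Or.inl (Or.inl rfl))⟩

/-! ### Group-theoretic and Lie-theoretic notions -/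

/-- The left-normed commutator `[g, a, …, a]` with `k` entries `a`, where
`[g, a] = g⁻¹ a⁻¹ g a`. -/
def engelComm {H : Type*} [Group H] (g a : H) : ℕ → H
  | 0 => g
  | k + 1 => (engelComm g a k)⁻¹ * a⁻¹ * engelComm g a k * a

/-- `a` is a left `k`-Engel element: `[g, a, …, a] = 1` (`k` entries `a`) for all `g`. -/
def IsLeftEngel {H : Type*} [Group H] (k : ℕ) (a : H) : Prop := ∀ g : H, engelComm g a k = 1

/-- A group is locally finite if all its finitely generated subgroups are finite. -/
def IsLocallyFinite (H : Type*) [Group H] : Prop :=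
  ∀ K : Subgroup H, K.FG → Finite K

/-- A group is locally nilpotent if all its finitely generated subgroups are nilpotent. -/
def IsLocallyNilpotent (H : Type*) [Group H] : Prop :=
  ∀ K : Subgroup H, K.FG → Group.IsNilpotent K

/-- A Lie algebra is locally nilpotent if all its finitely generated subalgebras are nilpotent. -/
def IsLieLocallyNilpotent (R M : Type*) [CommRing R] [LieRing M] [LieAlgebra R M] : Prop :=
  ∀ s : Set M, s.Finite → LieRing.IsNilpotent (LieSubalgebra.lieSpan R M s)

end EngelTwo

namespace EngelTwo

/-! ### Square-zero elements of rings of characteristic two -/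

/-! The common source of the Engel and commutator statements is that `x` and all `z_A` are sandwich
elements: `ad(y)² = 0` and `ad(y) ad(u) ad(y) = 0` for all `u` (`isSandwich_x`, `isSandwich_copy`).
For `z_A` this is a matter of supports: after one product with `z_A` everything lives on sets
containing `A`, and a second factor `z_A` kills it. For `x`, the image of `ad(x)` consists of copies
of `v(0)`, products of `v(0)` with `L` stay in the span of the `v(i)`, and `x` annihilates that
span.

If `y` is a sandwich, then `1 + ad(y)` is a Lie automorphism, so `G` acts on `L*` by automorphisms
(`G.map_lie`). Hence the conjugate `g⁻¹ a g` is `1 + Y` with `Y = ad(g⁻¹ x)`, while `a = 1 + X` with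
`X = ad(x)`. The sandwich identity `XYX = 0` forces `((1 + Y)(1 + X))⁴ = 1`
(`one_add_mul_pow_four`). Since `a` is an involution, it inverts `u = [g, a]`, so the triple
commutator is `u⁴` (`engelComm_three_eq_one`).

For the normal closure, group commutators of sandwich involutions reproduce Lie brackets
(`IsSandwich.commutator`). From `a` and `w_A` one gets `v(0)_A`; commuting with copies of `w` on
fresh singletons raises the index to `n - 1`; since `v(n-1) · w = w`, copies of `w` on large enough
sets lie in the normal closure, and commuting with `v(n-1)_B` reproduces `w` on a larger set. So
every lower central term contains a nontrivial `w_A` (`w_mem_lowerCentralSeries`).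

The local statements use a finite set `P` of naturals meeting all the finitely many index sets in
play. Each product with such an element of `W*` raises the number of points of `P` in the support, a
number bounded by `|P|`, and `x` acts with square zero without lowering it. Interleaving these two
facts gives a finite chain of subspaces along which every operator moves one step
(`LStar.ad_mem_shiftBy`). Lie nilpotency follows directly; on the group side, a stabilizer of such a
chain over the field with two elements is nilpotent of 2-power exponent, and finite when finitely
generated. -/

/-- Both factors are their own inverses, so the left side is a group commutator. In its expansion
all other terms cancel in pairs or contain one of the four vanishing words. -/
theorem one_add_commutator {R : Type*} [Ring R] (h2 : ∀ a : R, a + a = 0) {Y Z : R}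
    (hY : Y * Y = 0) (hZ : Z * Z = 0) (hYZY : Y * Z * Y = 0) (hZYZ : Z * Y * Z = 0) :
    (1 + Y) * (1 + Z) * (1 + Y) * (1 + Z) = 1 + (Y * Z - Z * Y) := by
  have key : (1 + Y) * (1 + Z) * (1 + Y) * (1 + Z) = 1 + (Y * Z - Z * Y)
      + ((Y + Z + Y * Z + Z * Y) + (Y + Z + Y * Z + Z * Y)) + Y * Y * (1 + Z)
      + (1 + Y) * (Z * Z) + Y * Z * Y * (1 + Z) + Z * Y * Z := by noncomm_ring
  rw [key, h2, hY, hZ, hYZY, hZYZ]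
  simp

/-- The square is `1 + T` with `T = XY + YX + YXY`, and every word in `T²` contains `XX`, `YY` or
`XYX`, so squaring once more gives `1`. -/
theorem one_add_mul_pow_four {R : Type*} [Ring R] (h2 : ∀ a : R, a + a = 0) {X Y : R}
    (hX : X * X = 0) (hY : Y * Y = 0) (hXYX : X * Y * X = 0) :
    ((1 + Y) * (1 + X)) ^ 4 = 1 := by
  have hX' (a : R) : X * (X * a) = 0 := by rw [← mul_assoc, hX, zero_mul]
  have hY' (a : R) : Y * (Y * a) = 0 := by rw [← mul_assoc, hY, zero_mul]
  have h1 : X * (Y * X) = 0 := by rw [← mul_assoc, hXYX]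
  have h1' (a : R) : X * (Y * (X * a)) = 0 := by
    rw [← mul_assoc, ← mul_assoc, hXYX, zero_mul]
  have sq : ((1 + Y) * (1 + X)) ^ 2 = 1 + (X * Y + Y * X + Y * X * Y) := by
    have key : ((1 + Y) * (1 + X)) ^ 2 = 1 + (X * Y + Y * X + Y * X * Y)
        + ((Y + X + Y * X) + (Y + X + Y * X)) + Y * Y * (1 + X)
        + (1 + Y) * (X * X) + Y * (X * Y * X) + X * Y * X := by noncomm_ring
    rw [key, h2, hX, hY, hXYX]
    simp
  have hT : (X * Y + Y * X + Y * X * Y) * (X * Y + Y * X + Y * X * Y) = 0 := by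
    simp only [mul_add, add_mul, mul_assoc, hX', hY', h1, h1', mul_zero, add_zero]
  rw [show 4 = 2 * 2 from rfl, pow_mul, sq]
  generalize X * Y + Y * X + Y * X * Y = T at hT
  have : (1 + T) ^ 2 = 1 + (T + T) + T * T := by noncomm_ring
  rw [this, h2, hT, add_zero, add_zero]

/-- The involution `a` inverts `u = [g, a]`, hence all powers of `u`. So `[u, a] = u⁻²` and `[u⁻²,
a] = u⁴`. -/
theorem engelComm_three_eq_one {H : Type*} [Group H] {g a : H} (ha : a * a = 1)
    (h : (g⁻¹ * a * g * a) ^ 4 = 1) : engelComm g a 3 = 1 := by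
  have hi : a⁻¹ = a := inv_eq_of_mul_eq_one_left ha
  have hu : ∀ u : H, a * u * a = u⁻¹ → u⁻¹ * a * u * a = (u ^ 2)⁻¹ := by
    intro u hu
    rw [mul_assoc, mul_assoc, ← mul_assoc a, hu]
    group
  have h1 : a * (g⁻¹ * a * g * a) * a = (g⁻¹ * a * g * a)⁻¹ := by
    simp only [mul_inv_rev, hi, inv_inv, mul_assoc, ha, mul_one]
  simp only [engelComm, hi]
  generalize g⁻¹ * a * g * a = u at h h1
  rw [hu u h1]
  have h2 : a * (u ^ 2)⁻¹ * a = u ^ 2 := by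
    have : a * (u ^ 2)⁻¹ * a = (a * u * a * (a * u * a))⁻¹ := by
      simp only [mul_inv_rev, hi, mul_assoc, pow_two]
      rw [← mul_assoc a a, ha, one_mul]
    rw [this, h1]
    group
  rw [hu _ (by rw [h2, inv_inv]), inv_pow, inv_inv, ← pow_mul]
  exact h

/-! ### Groups stabilizing a finite chain of subspaces -/

section Stability

variable {E : Type*} [AddCommGroup E] [Module (ZMod 2) E]

/-- The operators that map `V k` into `V (k + i)` for all `k`. -/
def shiftBy (V : ℕ → Submodule (ZMod 2) E) (i : ℕ) : Submodule (ZMod 2) (Module.End (ZMod 2) E) where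
  carrier := {T | ∀ k, ∀ y ∈ V k, T y ∈ V (k + i)}
  add_mem' hS hT k y hy := add_mem (hS k y hy) (hT k y hy)
  zero_mem' _ _ _ := zero_mem _
  smul_mem' t _ hT k y hy := Submodule.smul_mem _ t (hT k y hy)

variable {V : ℕ → Submodule (ZMod 2) E}

theorem shiftBy_mul {i j : ℕ} {S T : Module.End (ZMod 2) E} (hS : S ∈ shiftBy V i)
    (hT : T ∈ shiftBy V j) : S * T ∈ shiftBy V (i + j) := by
  intro k y hy
  rw [add_comm i, ← add_assoc]
  exact hS _ _ (hT k y hy)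

theorem one_mem_shiftBy : (1 : Module.End (ZMod 2) E) ∈ shiftBy V 0 := fun _ _ hy => hy

theorem shiftBy_anti (hV : Antitone V) : Antitone (shiftBy V) :=
  fun _ _ hij _ hT k y hy => hV (Nat.add_le_add_left hij k) (hT k y hy)

theorem eq_zero_of_mem_shiftBy {c : ℕ} (h0 : V 0 = ⊤) (hc : V c = ⊥)
    {T : Module.End (ZMod 2) E} (hT : T ∈ shiftBy V c) : T = 0 := by
  ext y
  have := hT 0 y (h0 ▸ Submodule.mem_top)
  rwa [zero_add, hc, Submodule.mem_bot] at this

theorem pow_mem_shiftBy {T : Module.End (ZMod 2) E} (hT : T ∈ shiftBy V 1) (k : ℕ) :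
    T ^ k ∈ shiftBy V k := by
  induction k with
  | zero => exact one_mem_shiftBy
  | succ k ih => exact pow_succ T k ▸ shiftBy_mul ih hT

theorem end_add_self (T : Module.End (ZMod 2) E) : T + T = 0 := by
  rw [← two_smul (ZMod 2) T, show (2 : ZMod 2) = 0 from rfl, zero_smul]

theorem mem_shiftBy_zero (hV : Antitone V) {i : ℕ} {g : Module.End (ZMod 2) E}
    (h : g - 1 ∈ shiftBy V i) : g ∈ shiftBy V 0 :=
  sub_add_cancel g 1 ▸ add_mem (shiftBy_anti hV (Nat.zero_le i) h) one_mem_shiftBy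

/-- The invertible operators `g` such that `g - 1` and `g⁻¹ - 1` map `V k` into `V (k + i)` for all
`k`. -/
def stabilizer (V : ℕ → Submodule (ZMod 2) E) (hV : Antitone V) (i : ℕ) :
    Subgroup (LinearMap.GeneralLinearGroup (ZMod 2) E) where
  carrier := {g | (g : Module.End (ZMod 2) E) - 1 ∈ shiftBy V i ∧
    ((g⁻¹ : LinearMap.GeneralLinearGroup (ZMod 2) E) : Module.End (ZMod 2) E) - 1 ∈ shiftBy V i}
  mul_mem' := by
    have key : ∀ S T : Module.End (ZMod 2) E, S - 1 ∈ shiftBy V i → T - 1 ∈ shiftBy V i →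
        S * T - 1 ∈ shiftBy V i := by
      intro S T hS hT
      rw [show S * T - 1 = (S - 1) * T + (T - 1) by noncomm_ring]
      exact add_mem (shiftBy_mul hS (mem_shiftBy_zero hV hT)) hT
    intro g h hg hh
    refine ⟨?_, ?_⟩
    · rw [Units.val_mul]; exact key _ _ hg.1 hh.1
    · rw [mul_inv_rev, Units.val_mul]; exact key _ _ hh.2 hg.2
  one_mem' := by simp
  inv_mem' hg := ⟨hg.2, by rw [inv_inv]; exact hg.1⟩

/-- The ring commutator of `g` and `h` equals that of `g - 1` and `h - 1`, which shifts by `i + j`;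
multiplying by `g⁻¹h⁻¹` does not spoil this. The inverse is the commutator with `g` and `h`
exchanged. -/
theorem commutator_mem_stabilizer (hV : Antitone V) {i j : ℕ}
    {g h : LinearMap.GeneralLinearGroup (ZMod 2) E} (hg : g ∈ stabilizer V hV i)
    (hh : h ∈ stabilizer V hV j) : g * h * g⁻¹ * h⁻¹ ∈ stabilizer V hV (i + j) := by
  have key : ∀ {i j : ℕ} {g h : LinearMap.GeneralLinearGroup (ZMod 2) E},
      g ∈ stabilizer V hV i → h ∈ stabilizer V hV j →
      ((g * h * g⁻¹ * h⁻¹ : LinearMap.GeneralLinearGroup (ZMod 2) E) : Module.End (ZMod 2) E) - 1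
        ∈ shiftBy V (i + j) := by
    intro i j g h hg hh
    have e : ((g * h * g⁻¹ * h⁻¹ : LinearMap.GeneralLinearGroup (ZMod 2) E) :
        Module.End (ZMod 2) E) - 1 =
        (((g : Module.End (ZMod 2) E) - 1) * ((h : Module.End (ZMod 2) E) - 1)
          - ((h : Module.End (ZMod 2) E) - 1) * ((g : Module.End (ZMod 2) E) - 1))
        * ((g⁻¹ : LinearMap.GeneralLinearGroup (ZMod 2) E) : Module.End (ZMod 2) E)
        * ((h⁻¹ : LinearMap.GeneralLinearGroup (ZMod 2) E) : Module.End (ZMod 2) E) := by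
      have h1 : (h : Module.End (ZMod 2) E) * g
          * ((g⁻¹ : LinearMap.GeneralLinearGroup (ZMod 2) E) : Module.End (ZMod 2) E)
          * ((h⁻¹ : LinearMap.GeneralLinearGroup (ZMod 2) E) : Module.End (ZMod 2) E) = 1 := by
        rw [← Units.val_mul, ← Units.val_mul, ← Units.val_mul, mul_assoc h g, mul_inv_cancel,
          mul_one, mul_inv_cancel, Units.val_one]
      simp only [Units.val_mul]
      -- Writing `1` as `h g g⁻¹ h⁻¹` turns the left side into `(gh - hg) g⁻¹ h⁻¹`.
      nth_rewrite 1 [← h1]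
      noncomm_ring
    rw [e]
    have hc := sub_mem (shiftBy_mul hg.1 hh.1) (add_comm j i ▸ shiftBy_mul hh.1 hg.1)
    exact shiftBy_mul (j := 0) (shiftBy_mul (j := 0) hc (mem_shiftBy_zero hV hg.2))
      (mem_shiftBy_zero hV hh.2)
  refine ⟨key hg hh, ?_⟩
  have := key hh hg
  rw [add_comm j] at this
  rwa [show (g * h * g⁻¹ * h⁻¹)⁻¹ = h * g * h⁻¹ * g⁻¹ by group]

theorem eq_one_of_mem_stabilizer (hV : Antitone V) {c : ℕ} (h0 : V 0 = ⊤) (hc : V c = ⊥)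
    {g : LinearMap.GeneralLinearGroup (ZMod 2) E} (hg : g ∈ stabilizer V hV c) : g = 1 :=
  Units.ext (sub_eq_zero.1 (eq_zero_of_mem_shiftBy h0 hc hg.1))

theorem pow_eq_one_of_mem_stabilizer (hV : Antitone V) {c : ℕ} (h0 : V 0 = ⊤) (hc : V c = ⊥)
    {g : LinearMap.GeneralLinearGroup (ZMod 2) E} (hg : g ∈ stabilizer V hV 1) :
    g ^ 2 ^ c = 1 := by
  have key : ∀ T : Module.End (ZMod 2) E, ∀ k, (1 + T) ^ 2 ^ k = 1 + T ^ 2 ^ k := by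
    intro T k
    induction k with
    | zero => simp
    | succ k ih =>
      rw [pow_succ, pow_mul, ih, pow_mul T]
      generalize T ^ 2 ^ k = S
      rw [show (1 + S) ^ 2 = 1 + (S + S) + S ^ 2 by noncomm_ring, end_add_self, add_zero]
  apply Units.ext
  have h := key ((g : Module.End (ZMod 2) E) - 1) c
  rw [add_sub_cancel] at h
  -- Since `c ≤ 2 ^ c`, this power shifts past the end of the chain.
  have hz : ((g : Module.End (ZMod 2) E) - 1) ^ 2 ^ c = 0 := eq_zero_of_mem_shiftBy h0 hc
    (shiftBy_anti hV Nat.lt_two_pow_self.le (pow_mem_shiftBy hg.1 _))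
  rw [Units.val_pow_eq_pow_val, h, Units.val_one, hz, add_zero]

/-- The stabilizers with shifts `1, 2, 3, …` form a descending central series. Numbering starts at
shift `1`, so term `c` has shift `c + 1`, more than is needed to be trivial. -/
theorem isNilpotent_of_stabilizer (hV : Antitone V) {c : ℕ} (h0 : V 0 = ⊤) (hc : V c = ⊥)
    {K : Type*} [Group K] (φ : K →* LinearMap.GeneralLinearGroup (ZMod 2) E)
    (hφ : Function.Injective φ) (h : ∀ g, φ g ∈ stabilizer V hV 1) : Group.IsNilpotent K := by
  rw [Subgroup.nilpotent_iff_finite_descending_central_series]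
  refine ⟨c, fun n => (stabilizer V hV (n + 1)).comap φ, ⟨?_, ?_⟩, ?_⟩
  · rw [eq_top_iff]; exact fun g _ => h g
  · intro g n hg k
    change φ (g * k * g⁻¹ * k⁻¹) ∈ stabilizer V hV (n + 1 + 1)
    rw [map_mul, map_mul, map_mul, map_inv, map_inv]
    exact commutator_mem_stabilizer hV hg (h k)
  · rw [eq_bot_iff]
    intro g hg
    apply hφ
    rw [map_one]
    refine eq_one_of_mem_stabilizer hV h0 hc ?_
    have hm : (g : K) ∈ (stabilizer V hV (c + 1)).comap φ := hg
    exact ⟨shiftBy_anti hV (Nat.le_succ c) hm.1, shiftBy_anti hV (Nat.le_succ c) hm.2⟩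

open Pointwise in
-- All products of more than `c` operators `g - 1` vanish. Hence the products of at most `c` of
-- them, with `g` in a finite generating set, span a finite space closed under left multiplication
-- by each `g - 1`, and this space contains the image of `K`.
theorem finite_of_stabilizer (hV : Antitone V) {c : ℕ} (h0 : V 0 = ⊤) (hc : V c = ⊥)
    {K : Type*} [Group K] [Group.FG K] (φ : K →* LinearMap.GeneralLinearGroup (ZMod 2) E)
    (hφ : Function.Injective φ) (h : ∀ g, φ g ∈ stabilizer V hV 1) : Finite K := by
  -- Generating `K` as a monoid avoids inverses in the induction on words.
  obtain ⟨s, hs, hfin⟩ := Monoid.fg_iff.1 (Group.fg_iff_monoid_fg.1 ‹_›)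
  let F : K → Module.End (ZMod 2) E := fun g => (φ g : Module.End (ZMod 2) E)
  have hF : Function.Injective F := Units.val_injective.comp hφ
  let T : Set (Module.End (ZMod 2) E) := (fun g => F g - 1) '' s
  have hT : T.Finite := hfin.image _
  have hTpow : ∀ k, (T ^ k).Finite := by
    intro k
    induction k with
    | zero => rw [pow_zero]; exact Set.finite_one
    | succ k ih => rw [pow_succ']; exact hT.mul ih
  have hTshift : ∀ k, ∀ t ∈ T ^ k, t ∈ shiftBy V k := by
    intro k
    induction k with
    | zero =>
      intro t ht
      rw [pow_zero, Set.mem_one] at ht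
      exact ht ▸ one_mem_shiftBy
    | succ k ih =>
      intro t ht
      rw [pow_succ'] at ht
      obtain ⟨_, ⟨g, _, rfl⟩, u, hu, rfl⟩ := Set.mem_mul.1 ht
      exact add_comm 1 k ▸ shiftBy_mul (h g).1 (ih u hu)
  let S : Submodule (ZMod 2) (Module.End (ZMod 2) E) :=
    Submodule.span (ZMod 2) (⋃ k ∈ Set.Iic c, T ^ k)
  have hSfin : Finite S := by
    have : Module.Finite (ZMod 2) S :=
      Module.Finite.span_of_finite _ ((Set.finite_Iic c).biUnion fun k _ => hTpow k)
    exact Module.finite_of_finite (ZMod 2)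
  have hmul : ∀ t ∈ T, ∀ y ∈ S, t * y ∈ S := by
    intro t ht y hy
    induction hy using Submodule.span_induction with
    | zero => rw [mul_zero]; exact zero_mem _
    | add y z _ _ hy hz => rw [mul_add]; exact add_mem hy hz
    | smul r y _ hy => rw [mul_smul_comm]; exact Submodule.smul_mem _ _ hy
    | mem y hy =>
      obtain ⟨k, hk, hy⟩ := Set.mem_iUnion₂.1 hy
      have hty : t * y ∈ T ^ (k + 1) := pow_succ' T k ▸ Set.mul_mem_mul ht hy
      by_cases hkc : k + 1 ≤ c
      · exact Submodule.subset_span (Set.mem_iUnion₂.2 ⟨k + 1, hkc, hty⟩)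
      · rw [eq_zero_of_mem_shiftBy h0 hc (shiftBy_anti hV (by omega) (hTshift _ _ hty))]
        exact zero_mem _
  have hmem : ∀ g, F g ∈ S := by
    intro g
    have hg : g ∈ Submonoid.closure s := hs ▸ Submonoid.mem_top g
    induction hg using Submonoid.closure_induction_left with
    | one =>
      refine Submodule.subset_span (Set.mem_iUnion₂.2 ⟨0, Nat.zero_le c, ?_⟩)
      simp [F]
    | mul_left x hx y _ hy =>
      have : F (x * y) = (F x - 1) * F y + F y := by simp [F, sub_mul]
      rw [this]
      exact add_mem (hmul _ ⟨x, hx, rfl⟩ _ hy) hy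
  exact Finite.of_injective (fun g => (⟨F g, hmem g⟩ : S)) fun _ _ e => hF (Subtype.ext_iff.1 e)

end Stability

/-! ### Sandwich elements of `L*` -/

section Sandwich

variable {m : ℕ} {𝒜 : SetFamily}

/-- An element `y` such that `ad(y)² = 0` and `ad(y) ad(u) ad(y) = 0` for all `u`. -/
def IsSandwich (y : LStar m 𝒜) : Prop :=
  (∀ z : LStar m 𝒜, ⁅y, ⁅y, z⁆⁆ = 0) ∧ ∀ u z : LStar m 𝒜, ⁅y, ⁅u, ⁅y, z⁆⁆⁆ = 0

theorem IsSandwich.ad_sq {y : LStar m 𝒜} (hy : IsSandwich y) :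
    LieAlgebra.ad (ZMod 2) (LStar m 𝒜) y * LieAlgebra.ad (ZMod 2) (LStar m 𝒜) y = 0 :=
  LinearMap.ext hy.1

theorem IsSandwich.ad_mul_ad {y : LStar m 𝒜} (hy : IsSandwich y) (u : LStar m 𝒜) :
    LieAlgebra.ad (ZMod 2) (LStar m 𝒜) y * LieAlgebra.ad (ZMod 2) (LStar m 𝒜) u *
      LieAlgebra.ad (ZMod 2) (LStar m 𝒜) y = 0 :=
  LinearMap.ext (hy.2 u)

theorem IsSandwich.lie_lie_lie {y : LStar m 𝒜} (hy : IsSandwich y) (u v : LStar m 𝒜) :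
    ⁅⁅y, u⁆, ⁅y, v⁆⁆ = 0 := by
  have := leibniz_lie y u ⁅y, v⁆
  rw [hy.2, hy.1, lie_zero, add_zero] at this
  exact this.symm

theorem oneAddAd_val (y : LStar m 𝒜)
    (hy : LieAlgebra.ad (ZMod 2) (LStar m 𝒜) y * LieAlgebra.ad (ZMod 2) (LStar m 𝒜) y = 0) :
    (oneAddAd y hy : Module.End (ZMod 2) (LStar m 𝒜)) = 1 + LieAlgebra.ad (ZMod 2) (LStar m 𝒜) y :=
  rfl

theorem oneAddAd_apply (y : LStar m 𝒜)
    (hy : LieAlgebra.ad (ZMod 2) (LStar m 𝒜) y * LieAlgebra.ad (ZMod 2) (LStar m 𝒜) y = 0)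
    (z : LStar m 𝒜) : (oneAddAd y hy : Module.End (ZMod 2) (LStar m 𝒜)) z = z + ⁅y, z⁆ :=
  rfl

theorem oneAddAd_inv (y : LStar m 𝒜)
    (hy : LieAlgebra.ad (ZMod 2) (LStar m 𝒜) y * LieAlgebra.ad (ZMod 2) (LStar m 𝒜) y = 0) :
    (oneAddAd y hy)⁻¹ = oneAddAd y hy :=
  rfl

theorem oneAddAd_mul_self (y : LStar m 𝒜)
    (hy : LieAlgebra.ad (ZMod 2) (LStar m 𝒜) y * LieAlgebra.ad (ZMod 2) (LStar m 𝒜) y = 0) :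
    oneAddAd y hy * oneAddAd y hy = 1 :=
  inv_mul_cancel (oneAddAd y hy)

theorem orderOf_oneAddAd (y : LStar m 𝒜)
    (hy : LieAlgebra.ad (ZMod 2) (LStar m 𝒜) y * LieAlgebra.ad (ZMod 2) (LStar m 𝒜) y = 0)
    (z : LStar m 𝒜) (hz : ⁅y, z⁆ ≠ 0) : orderOf (oneAddAd y hy) = 2 := by
  refine orderOf_eq_prime (by rw [pow_two, oneAddAd_mul_self]) fun h => hz ?_
  have : (oneAddAd y hy : Module.End (ZMod 2) (LStar m 𝒜)) z = z := by rw [h]; rfl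
  rwa [oneAddAd_apply, add_eq_left] at this

/-- The derivation property accounts for the linear terms; the quadratic term `⁅⁅y, u⁆, ⁅y, v⁆⁆` is
zero by the sandwich identities. -/
theorem IsSandwich.oneAddAd_lie {y : LStar m 𝒜} (hy : IsSandwich y)
    (hy' : LieAlgebra.ad (ZMod 2) (LStar m 𝒜) y * LieAlgebra.ad (ZMod 2) (LStar m 𝒜) y = 0)
    (u v : LStar m 𝒜) :
    (oneAddAd y hy' : Module.End (ZMod 2) (LStar m 𝒜)) ⁅u, v⁆ =
      ⁅(oneAddAd y hy' : Module.End (ZMod 2) (LStar m 𝒜)) u,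
        (oneAddAd y hy' : Module.End (ZMod 2) (LStar m 𝒜)) v⁆ := by
  simp only [oneAddAd_apply, lie_add, add_lie, hy.lie_lie_lie, add_zero]
  rw [leibniz_lie y u v]
  abel

theorem IsSandwich.commutator {y z : LStar m 𝒜} (hy : IsSandwich y) (hz : IsSandwich z)
    (hy' : LieAlgebra.ad (ZMod 2) (LStar m 𝒜) y * LieAlgebra.ad (ZMod 2) (LStar m 𝒜) y = 0)
    (hz' : LieAlgebra.ad (ZMod 2) (LStar m 𝒜) z * LieAlgebra.ad (ZMod 2) (LStar m 𝒜) z = 0)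
    (h : LieAlgebra.ad (ZMod 2) (LStar m 𝒜) ⁅y, z⁆ * LieAlgebra.ad (ZMod 2) (LStar m 𝒜) ⁅y, z⁆ = 0) :
    oneAddAd y hy' * oneAddAd z hz' * (oneAddAd y hy')⁻¹ * (oneAddAd z hz')⁻¹ =
      oneAddAd ⁅y, z⁆ h := by
  have e : LieAlgebra.ad (ZMod 2) (LStar m 𝒜) y * LieAlgebra.ad (ZMod 2) (LStar m 𝒜) z -
      LieAlgebra.ad (ZMod 2) (LStar m 𝒜) z * LieAlgebra.ad (ZMod 2) (LStar m 𝒜) y =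
      LieAlgebra.ad (ZMod 2) (LStar m 𝒜) ⁅y, z⁆ :=
    LinearMap.ext fun u => (lie_lie y z u).symm
  apply Units.ext
  rw [oneAddAd_inv, oneAddAd_inv, Units.val_mul, Units.val_mul,
    Units.val_mul, oneAddAd_val, oneAddAd_val, oneAddAd_val, one_add_commutator end_add_self
    hy.ad_sq hz.ad_sq (hy.ad_mul_ad z) (hz.ad_mul_ad y), e]

end Sandwich

/-! ### Products in `L` and supports in `W*` -/

theorem L.lie_x_v (m i : ℕ) : ⁅L.x m, L.v m i⁆ = 0 := by
  by_cases h : i < dim m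
  · rw [L.v, dif_pos h, L.x, L.lie_basis]; rfl
  · rw [L.v, dif_neg h, lie_zero]

theorem L.lie_x_basis {m : ℕ} (b : Idx m) :
    ⁅L.x m, L.basis b⁆ = 0 ∨ ⁅L.x m, L.basis b⁆ = L.v m 0 := by
  rw [L.x, L.lie_basis]
  cases b
  · exact Or.inl rfl
  · exact Or.inr rfl
  · exact Or.inl rfl

theorem two_le_dim {m : ℕ} (hm : 2 ≤ m) : 2 ≤ dim m := by
  have : 2 ^ 2 ≤ 2 ^ m := Nat.pow_le_pow_right (by norm_num) hm
  unfold dim; omega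

theorem L.lie_x_lie_lie_x {m : ℕ} (hm : 2 ≤ m) (z t : L m) : ⁅L.x m, ⁅z, ⁅L.x m, t⁆⁆⁆ = 0 := by
  have hn := two_le_dim hm
  induction t using L.induction with
  | h0 => simp
  | hadd f g hf hg => rw [lie_add, lie_add, lie_add, hf, hg, add_zero]
  | hb c =>
    rcases L.lie_x_basis c with h | h <;> rw [h]
    · simp
    induction z using L.induction with
    | h0 => simp
    | hadd f g hf hg => rw [add_lie, lie_add, hf, hg, add_zero]
    | hb b =>
      have h0 : L.v m 0 = L.basis (.v ⟨0, by omega⟩) := L.v_fin ⟨0, by omega⟩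
      rw [h0, L.lie_basis]
      cases b with
      | v i =>
        change ⁅L.x m, _ • L.v m _⁆ = 0
        rw [lie_smul, L.lie_x_v, smul_zero]
      | w =>
        simp only [L.table]
        -- Here `n ≥ 2` matters: it makes `w · v(0)` equal to `v(1)` rather than `w`, which `x`
        -- would not annihilate.
        rw [if_pos (by omega), L.lie_x_v]
      | x => exact lie_zero _

/-- Only disjoint pairs contribute to a product. If no member of `S` is disjoint from a member of
`T`, then `R = ∅` is allowed and the product vanishes. -/
theorem WStar.mul_mem_supported {m : ℕ} {𝒜 : SetFamily} {S T R : Set 𝒜.sets}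
    (h : ∀ A ∈ S, ∀ B ∈ T, ∀ hd : Disjoint (A : Set ℕ) B,
      (⟨(A : Set ℕ) ∪ B, 𝒜.union_mem A A.2 B B.2 hd⟩ : 𝒜.sets) ∈ R) {f g : WStar m 𝒜}
    (hf : f ∈ Finsupp.supported (W m) (ZMod 2) S) (hg : g ∈ Finsupp.supported (W m) (ZMod 2) T) :
    WStar.mul m 𝒜 f g ∈ Finsupp.supported (W m) (ZMod 2) R := by
  rw [← f.sum_single, ← g.sum_single, Finsupp.sum, Finsupp.sum]
  simp only [map_sum, LinearMap.sum_apply]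
  refine sum_mem fun B hB => sum_mem fun A hA => ?_
  rw [WStar.mul_single]
  by_cases hd : Disjoint (A : Set ℕ) (B : Set ℕ)
  · rw [place_disj hd]
    exact Finsupp.single_mem_supported _ _ (h A (hf hA) B (hg hB) hd)
  · rw [place_not hd]
    exact zero_mem _

theorem WStar.actX_mem_supported {m : ℕ} {𝒜 : SetFamily} {S : Set 𝒜.sets} {f : WStar m 𝒜}
    (hf : f ∈ Finsupp.supported (W m) (ZMod 2) S) :
    WStar.actX m 𝒜 f ∈ Finsupp.supported (W m) (ZMod 2) S := by
  rw [← f.sum_single, Finsupp.sum, map_sum]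
  refine sum_mem fun A hA => ?_
  rw [WStar.actX_single]
  exact Finsupp.single_mem_supported _ _ (hf hA)

theorem WStar.actX_actX {m : ℕ} {𝒜 : SetFamily} (f : WStar m 𝒜) :
    WStar.actX m 𝒜 (WStar.actX m 𝒜 f) = 0 := by
  induction f using Finsupp.induction_linear with
  | zero => simp
  | add f f' e e' => simp only [map_add, e, e', add_zero]
  | single A z =>
    rw [WStar.actX_single, WStar.actX_single, show ⁅L.x m, ⁅L.x m, z⁆⁆ = 0 from
      Subtype.ext (lie_x_lie_x (z : L m)), Finsupp.single_zero]

theorem WStar.actX_mul_actX {m : ℕ} (hm : 2 ≤ m) {𝒜 : SetFamily} (f g : WStar m 𝒜) :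
    WStar.actX m 𝒜 (WStar.mul m 𝒜 f (WStar.actX m 𝒜 g)) = 0 := by
  induction f using Finsupp.induction_linear with
  | zero => simp
  | add f f' e e' => simp only [map_add, LinearMap.add_apply, e, e', add_zero]
  | single A z =>
    induction g using Finsupp.induction_linear with
    | zero => simp
    | add f f' e e' => simp only [map_add, e, e', add_zero]
    | single B t =>
      rw [WStar.actX_single, WStar.mul_single]
      by_cases h : Disjoint (A : Set ℕ) (B : Set ℕ)
      · rw [place_disj h, WStar.actX_single, show ⁅L.x m, ⁅z, ⁅L.x m, t⁆⁆⁆ = 0 from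
          Subtype.ext (L.lie_x_lie_lie_x hm (z : L m) (t : L m)), Finsupp.single_zero]
      · rw [place_not h, map_zero]

section Products

variable {m : ℕ} {𝒜 : SetFamily}

theorem LStar.x_lie_fst (y : LStar m 𝒜) :
    (⁅LStar.x m 𝒜, y⁆ : LStar m 𝒜).1 = WStar.actX m 𝒜 y.1 := by
  rw [LStar.lie_fst]
  simp [LStar.x]

theorem isSandwich_x (hm : 2 ≤ m) : IsSandwich (LStar.x m 𝒜) := by
  refine ⟨fun z => ?_, fun u z => ?_⟩
  · refine LStar.ext ?_ rfl
    rw [LStar.x_lie_fst, LStar.x_lie_fst]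
    exact WStar.actX_actX _
  · refine LStar.ext ?_ rfl
    rw [LStar.x_lie_fst, LStar.lie_fst, LStar.x_lie_fst, LStar.lie_snd]
    simp only [map_add, map_sub, map_smul, WStar.actX_actX, WStar.actX_mul_actX hm]
    simp only [smul_zero, add_zero, sub_zero, map_zero]
    rfl

theorem isSandwich_copy (z : W m) (A : 𝒜.sets) : IsSandwich (LStar.copy z A) := by
  let S : Set 𝒜.sets := {B | (A : Set ℕ) ⊆ B}
  have hz : (Finsupp.single A z : WStar m 𝒜) ∈ Finsupp.supported (W m) (ZMod 2) S :=
    Finsupp.single_mem_supported _ _ (Set.Subset.refl (A : Set ℕ))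
  have hl : ∀ y : LStar m 𝒜, (⁅LStar.copy z A, y⁆ : LStar m 𝒜).1 ∈
      Finsupp.supported (W m) (ZMod 2) S := by
    intro y
    refine sub_mem (add_mem (WStar.mul_mem_supported (T := Set.univ) ?_ hz (by simp)) ?_)
      (Submodule.smul_mem _ _ (WStar.actX_mem_supported hz))
    · intro B hB C _ _
      exact Set.Subset.trans hB Set.subset_union_left
    · rw [show (LStar.copy z A).2 = 0 from rfl, zero_smul]
      exact zero_mem _
  have hideal : ∀ u y : LStar m 𝒜, y.1 ∈ Finsupp.supported (W m) (ZMod 2) S → y.2 = 0 →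
      (⁅u, y⁆ : LStar m 𝒜).1 ∈ Finsupp.supported (W m) (ZMod 2) S := by
    intro u y hy hy2
    refine sub_mem (add_mem (WStar.mul_mem_supported (S := Set.univ) ?_ (by simp) hy)
      (Submodule.smul_mem _ _ (WStar.actX_mem_supported hy))) ?_
    · intro B _ C hC _
      exact Set.Subset.trans hC Set.subset_union_right
    · rw [hy2, zero_smul]
      exact zero_mem _
  have hkill : ∀ y : LStar m 𝒜, y.1 ∈ Finsupp.supported (W m) (ZMod 2) S → y.2 = 0 →
      ⁅LStar.copy z A, y⁆ = 0 := by
    intro y hy hy2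
    refine LStar.ext ?_ rfl
    -- Two sets containing the nonempty set `A` are never disjoint.
    have := WStar.mul_mem_supported (R := ∅) (fun B hB C hC hd =>
      not_disjoint_self A (Disjoint.mono hB hC hd)) hz hy
    rw [Finsupp.supported_empty, Submodule.mem_bot] at this
    rw [LStar.lie_fst, hy2, zero_smul, sub_zero]
    simp only [LStar.copy, zero_smul, add_zero, this]
    rfl
  exact ⟨fun y => hkill _ (hl y) rfl, fun u y => hkill _ (hideal u _ (hl y) rfl) rfl⟩

theorem LStar.copy_lie_copy (z t : W m) {A B : 𝒜.sets} (h : Disjoint (A : Set ℕ) (B : Set ℕ)) :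
    ⁅LStar.copy z A, LStar.copy t B⁆ =
      LStar.copy ⁅z, t⁆ ⟨(A : Set ℕ) ∪ B, 𝒜.union_mem A A.2 B B.2 h⟩ := by
  refine LStar.ext ?_ rfl
  rw [LStar.lie_fst]
  simp only [LStar.copy, zero_smul, add_zero, sub_zero]
  rw [WStar.mul_single, place_disj h]

theorem LStar.x_lie_copy (z : W m) (A : 𝒜.sets) :
    ⁅LStar.x m 𝒜, LStar.copy z A⁆ = LStar.copy ⁅L.x m, z⁆ A := by
  exact LStar.ext ((LStar.x_lie_fst _).trans (WStar.actX_single A z)) rfl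

theorem LStar.copy_ne_zero {z : W m} (hz : z ≠ 0) (A : 𝒜.sets) : LStar.copy z A ≠ 0 := fun h =>
  hz (Finsupp.single_eq_zero.1 (congrArg Prod.fst h))

theorem L.basis_ne_zero (b : Idx m) : L.basis b ≠ 0 := Finsupp.single_ne_zero.2 one_ne_zero

theorem W.w_ne_zero : W.w m ≠ 0 := fun h => L.basis_ne_zero _ (congrArg Subtype.val h)

theorem W.v_ne_zero (i : Fin (dim m)) : W.v m i ≠ 0 := fun h =>
  L.basis_ne_zero (.v i) ((L.v_fin i).symm.trans (congrArg Subtype.val h))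

theorem W.x_lie_w (h : 0 < dim m) : ⁅L.x m, W.w m⁆ = W.v m ⟨0, h⟩ :=
  Subtype.ext (L.lie_basis .x .w)

theorem W.v_lie_w_of_lt (i : Fin (dim m)) (h : (i : ℕ) + 1 < dim m) :
    ⁅W.v m i, W.w m⁆ = W.v m ⟨i + 1, h⟩ := by
  apply Subtype.ext
  change ⁅L.v m i, L.basis .w⁆ = L.v m (i + 1)
  rw [L.v_fin, L.lie_basis, L.table, if_pos h]

theorem W.v_lie_w_of_eq (i : Fin (dim m)) (h : (i : ℕ) + 1 = dim m) :
    ⁅W.v m i, W.w m⁆ = W.w m := by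
  apply Subtype.ext
  change ⁅L.v m i, L.basis .w⁆ = L.w m
  rw [L.v_fin, L.lie_basis, L.table, if_neg h.not_lt]

theorem W.v_lie_w_ne_zero (i : Fin (dim m)) : ⁅W.v m i, W.w m⁆ ≠ 0 := by
  by_cases h : (i : ℕ) + 1 < dim m
  · rw [W.v_lie_w_of_lt i h]; exact W.v_ne_zero _
  · rw [W.v_lie_w_of_eq i (by omega)]; exact W.w_ne_zero

theorem W.lie_comm (z t : W m) : ⁅z, t⁆ = ⁅t, z⁆ := by
  apply Subtype.ext
  exact L.mul_comm (z : L m) (t : L m)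

end Products

/-! ### Orders of the generators -/

section Orders

variable {m : ℕ} {𝒜 : SetFamily}

theorem orderOf_genX (hm : 2 ≤ m) (A : 𝒜.sets) : orderOf (genX m 𝒜) = 2 := by
  have hn := two_le_dim hm
  refine orderOf_oneAddAd _ _ (LStar.copy (W.w m) A) ?_
  rw [LStar.x_lie_copy, W.x_lie_w (by omega)]
  exact LStar.copy_ne_zero (W.v_ne_zero _) A

theorem orderOf_genW (hm : 2 ≤ m) (A : 𝒜.sets) : orderOf (genW (m := m) A) = 2 := by
  have hn := two_le_dim hm
  refine orderOf_oneAddAd _ _ (LStar.x m 𝒜) ?_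
  rw [← lie_skew, neg_ne_zero, LStar.x_lie_copy, W.x_lie_w (by omega)]
  exact LStar.copy_ne_zero (W.v_ne_zero _) A

/-- The moved vector is `w_B`. As `x` annihilates `v(i)`, nontriviality has to be detected inside
`W*`, which requires an index set disjoint from `A`. -/
theorem orderOf_genV (i : Fin (dim m)) {A B : 𝒜.sets} (h : Disjoint (A : Set ℕ) (B : Set ℕ)) :
    orderOf (genV i A) = 2 := by
  refine orderOf_oneAddAd _ _ (LStar.copy (W.w m) B) ?_
  rw [LStar.copy_lie_copy _ _ h]
  exact LStar.copy_ne_zero (W.v_lie_w_ne_zero i) _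

end Orders

/-! ### The left `3`-Engel element -/

section Engel

variable {m : ℕ} {𝒜 : SetFamily}

theorem G.map_lie (hm : 2 ≤ m) {g : LinearMap.GeneralLinearGroup (ZMod 2) (LStar m 𝒜)}
    (hg : g ∈ G m 𝒜) (u v : LStar m 𝒜) :
    (g : Module.End (ZMod 2) (LStar m 𝒜)) ⁅u, v⁆ =
      ⁅(g : Module.End (ZMod 2) (LStar m 𝒜)) u, (g : Module.End (ZMod 2) (LStar m 𝒜)) v⁆ := by
  induction hg using Subgroup.closure_induction generalizing u v with
  | mem g hg =>
    rcases hg with (rfl | ⟨p, rfl⟩) | ⟨A, rfl⟩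
    · exact (isSandwich_x hm).oneAddAd_lie _ u v
    · exact (isSandwich_copy _ _).oneAddAd_lie _ u v
    · exact (isSandwich_copy _ _).oneAddAd_lie _ u v
  | one => rfl
  | mul g h _ _ hg hh =>
    rw [Units.val_mul]
    simp only [Module.End.mul_apply, hg, hh]
  | inv g _ hg =>
    have hinv : ∀ z, (g : Module.End (ZMod 2) (LStar m 𝒜))
        (((g⁻¹ : LinearMap.GeneralLinearGroup (ZMod 2) (LStar m 𝒜)) :
          Module.End (ZMod 2) (LStar m 𝒜)) z) = z := fun z => by
      rw [← Module.End.mul_apply, Units.mul_inv]; rfl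
    have hinv' : ∀ z, ((g⁻¹ : LinearMap.GeneralLinearGroup (ZMod 2) (LStar m 𝒜)) :
        Module.End (ZMod 2) (LStar m 𝒜)) ((g : Module.End (ZMod 2) (LStar m 𝒜)) z) = z :=
      fun z => by rw [← Module.End.mul_apply, Units.inv_mul]; rfl
    -- Both entries are written as images under `g`, so that multiplicativity of `g` applies.
    conv_lhs => rw [← hinv u, ← hinv v, ← hg, hinv']

theorem isLeftEngel_a (hm : 2 ≤ m) : IsLeftEngel 3 (G.a m 𝒜) := by
  intro g
  have hx := isSandwich_x (𝒜 := 𝒜) hm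
  refine engelComm_three_eq_one (Subtype.ext (oneAddAd_mul_self _ hx.ad_sq)) ?_
  apply Subtype.ext
  apply Units.ext
  let γ : Module.End (ZMod 2) (LStar m 𝒜) := (g : LinearMap.GeneralLinearGroup (ZMod 2) (LStar m 𝒜))
  let δ : Module.End (ZMod 2) (LStar m 𝒜) :=
    ((g⁻¹ : G m 𝒜) : LinearMap.GeneralLinearGroup (ZMod 2) (LStar m 𝒜))
  let X := LieAlgebra.ad (ZMod 2) (LStar m 𝒜) (LStar.x m 𝒜)
  let Y := LieAlgebra.ad (ZMod 2) (LStar m 𝒜) (δ (LStar.x m 𝒜))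
  have hδγ : δ * γ = 1 := Units.inv_mul (g : LinearMap.GeneralLinearGroup (ZMod 2) (LStar m 𝒜))
  have hγδ : γ * δ = 1 := Units.mul_inv (g : LinearMap.GeneralLinearGroup (ZMod 2) (LStar m 𝒜))
  have hY : δ * X * γ = Y := by
    -- Conjugating `ad(x)` by a Lie automorphism gives the adjoint operator of the image of `x`.
    ext1 z
    change δ ⁅LStar.x m 𝒜, γ z⁆ = ⁅δ (LStar.x m 𝒜), z⁆
    rw [show δ ⁅LStar.x m 𝒜, γ z⁆ = ⁅δ (LStar.x m 𝒜), δ (γ z)⁆ from G.map_lie hm (g⁻¹).2 _ _,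
      ← Module.End.mul_apply, hδγ, Module.End.one_apply]
  have hX2 : X * X = 0 := hx.ad_sq
  have hY2 : Y * Y = 0 := by
    rw [← hY, show δ * X * γ * (δ * X * γ) = δ * X * (γ * δ) * X * γ by noncomm_ring, hγδ, mul_one,
      mul_assoc δ, hX2, mul_zero, zero_mul]
  have key := one_add_mul_pow_four end_add_self hX2 hY2 (hx.ad_mul_ad _)
  rw [← hY, show 1 + δ * X * γ = δ * (1 + X) * γ by rw [mul_add, add_mul, mul_one, hδγ]] at key
  exact key

end Engel

/-! ### The chain of subspaces attached to a finite set of natural numbers -/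

section Filtration

variable {m : ℕ} {𝒜 : SetFamily}

/-- The members of the family that have at least `j` elements in `P`. -/
def meetsIn (𝒜 : SetFamily) (P : Finset ℕ) (j : ℕ) : Set 𝒜.sets :=
  {A | j ≤ ((A : Set ℕ) ∩ P).ncard}

theorem meetsIn_anti (P : Finset ℕ) : Antitone (meetsIn 𝒜 P) := fun _ _ h _ hA => h.trans hA

theorem meetsIn_zero (P : Finset ℕ) : meetsIn 𝒜 P 0 = Set.univ :=
  Set.eq_univ_of_forall fun _ => Nat.zero_le _

theorem meetsIn_card_succ (P : Finset ℕ) : meetsIn 𝒜 P (P.card + 1) = ∅ := by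
  refine Set.eq_empty_of_forall_notMem fun A hA => ?_
  have h : ((A : Set ℕ) ∩ P).ncard ≤ (P : Set ℕ).ncard :=
    Set.ncard_le_ncard Set.inter_subset_right P.finite_toSet
  rw [Set.ncard_coe_finset] at h
  exact absurd (hA.trans h) (by omega)

theorem union_mem_meetsIn {P : Finset ℕ} {i j : ℕ} {A B : 𝒜.sets} (hA : A ∈ meetsIn 𝒜 P i)
    (hB : B ∈ meetsIn 𝒜 P j) (hd : Disjoint (A : Set ℕ) B) :
    (⟨(A : Set ℕ) ∪ B, 𝒜.union_mem A A.2 B B.2 hd⟩ : 𝒜.sets) ∈ meetsIn 𝒜 P (i + j) := by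
  change i + j ≤ (((A : Set ℕ) ∪ B) ∩ P).ncard
  -- The sets themselves may be infinite; `ncard` is additive here because the traces on `P` are
  -- finite.
  rw [Set.union_inter_distrib_right, Set.ncard_union_eq
    (hd.mono Set.inter_subset_left Set.inter_subset_left) (P.finite_toSet.inter_of_right _)
    (P.finite_toSet.inter_of_right _)]
  exact Nat.add_le_add hA hB

/-- One point of `A` in `P` suffices, even for infinite `A`. Stating this for all large `P` lets
finitely many such conditions be met by a single `P`. -/
theorem eventually_mem_meetsIn (A : 𝒜.sets) :
    ∀ᶠ P : Finset ℕ in Filter.atTop, A ∈ meetsIn 𝒜 P 1 := by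
  obtain ⟨a, ha⟩ := 𝒜.nonempty A A.2
  filter_upwards [Filter.eventually_ge_atTop {a}] with P hP
  change 0 < _
  rw [Set.ncard_pos (P.finite_toSet.inter_of_right _)]
  exact ⟨a, ha, hP (Finset.mem_singleton_self a)⟩

/-- The elements of `W*` supported on sets with at least `j` elements in `P`. -/
noncomputable def WStar.level (m : ℕ) (𝒜 : SetFamily) (P : Finset ℕ) (j : ℕ) : Submodule (ZMod 2) (WStar m 𝒜) :=
  Finsupp.supported (W m) (ZMod 2) (meetsIn 𝒜 P j)

theorem WStar.level_anti (P : Finset ℕ) : Antitone (WStar.level m 𝒜 P) :=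
  fun _ _ h => Finsupp.supported_mono (meetsIn_anti P h)

theorem WStar.mem_level_zero (P : Finset ℕ) (f : WStar m 𝒜) : f ∈ WStar.level m 𝒜 P 0 := by
  rw [WStar.level, meetsIn_zero, Finsupp.supported_univ]
  exact Submodule.mem_top

theorem WStar.mul_mem_level {P : Finset ℕ} {i j k : ℕ} {f g : WStar m 𝒜}
    (hf : f ∈ WStar.level m 𝒜 P i) (hg : g ∈ WStar.level m 𝒜 P j) (h : k ≤ i + j) :
    WStar.mul m 𝒜 f g ∈ WStar.level m 𝒜 P k :=
  WStar.mul_mem_supported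
    (fun _ hA _ hB hd => meetsIn_anti P h (union_mem_meetsIn hA hB hd)) hf hg

theorem WStar.actX_mem_level {P : Finset ℕ} {j : ℕ} {f : WStar m 𝒜}
    (hf : f ∈ WStar.level m 𝒜 P j) : WStar.actX m 𝒜 f ∈ WStar.level m 𝒜 P j :=
  WStar.actX_mem_supported hf

theorem eventually_mem_level (f : WStar m 𝒜) :
    ∀ᶠ P : Finset ℕ in Filter.atTop, f ∈ WStar.level m 𝒜 P 1 := by
  filter_upwards [(Filter.eventually_all_finset f.support).2 fun A _ => eventually_mem_meetsIn A]
    with P hP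
  exact fun A hA => hP A hA

/-- A chain of subspaces of `W*` that interleaves the levels with their preimages under the action
of `x`. -/
noncomputable def WStar.chain (m : ℕ) (𝒜 : SetFamily) (P : Finset ℕ) (k : ℕ) :
    Submodule (ZMod 2) (WStar m 𝒜) :=
  WStar.level m 𝒜 P (k / 2) ⊓ (WStar.level m 𝒜 P ((k + 1) / 2)).comap (WStar.actX m 𝒜)

/-- The chain of subspaces `L* ⊇ W* ⊇ …` attached to the finite set `P`. -/
noncomputable def LStar.chain (m : ℕ) (𝒜 : SetFamily) (P : Finset ℕ) :
    ℕ → Submodule (ZMod 2) (LStar m 𝒜)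
  | 0 => ⊤
  | k + 1 =>
    { carrier := {y | y.1 ∈ WStar.chain m 𝒜 P k ∧ y.2 = 0}
      add_mem' := fun {y z} hy hz => ⟨add_mem hy.1 hz.1, by rw [LStar.add_snd, hy.2, hz.2, add_zero]⟩
      zero_mem' := ⟨zero_mem _, rfl⟩
      smul_mem' := fun t y hy =>
        ⟨Submodule.smul_mem _ t hy.1, by rw [LStar.smul_snd, hy.2, mul_zero]⟩ }

theorem LStar.chain_anti (P : Finset ℕ) : Antitone (LStar.chain m 𝒜 P) := by
  refine antitone_nat_of_succ_le fun k => ?_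
  cases k with
  | zero => exact le_top
  | succ k =>
    intro y hy
    exact ⟨⟨WStar.level_anti P (by omega) hy.1.1, WStar.level_anti P (by omega) hy.1.2⟩, hy.2⟩

/-- Each of the levels `0, …, |P|` takes two steps, and the passage from `L*` to `W*` takes one
more. -/
theorem LStar.chain_eq_bot (P : Finset ℕ) : LStar.chain m 𝒜 P (2 * (P.card + 1) + 1) = ⊥ := by
  rw [eq_bot_iff]
  intro y hy
  have h : y.1 ∈ WStar.level m 𝒜 P (2 * (P.card + 1) / 2) := hy.1.1
  rw [Nat.mul_div_cancel_left _ two_pos, WStar.level, meetsIn_card_succ, Finsupp.supported_empty,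
    Submodule.mem_bot] at h
  exact LStar.ext h hy.2

/-- The `W*` part of `y` gains a full level, which is two steps. The `x` part gains one step:
membership in the chain already records the level of `x · z`, and the condition on `x · (x · z)` is
void. -/
theorem LStar.ad_mem_shiftBy {P : Finset ℕ} {y : LStar m 𝒜} (hy : y.1 ∈ WStar.level m 𝒜 P 1) :
    LieAlgebra.ad (ZMod 2) (LStar m 𝒜) y ∈ shiftBy (LStar.chain m 𝒜 P) 1 := by
  intro k z hz
  refine ⟨?_, rfl⟩
  rw [LieAlgebra.ad_apply, LStar.lie_fst]
  cases k with
  | zero => exact ⟨WStar.mem_level_zero P _, WStar.mem_level_zero P _⟩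
  | succ k =>
    obtain ⟨⟨h1, h2⟩, h3⟩ := hz
    rw [h3, zero_smul, sub_zero]
    have h2' : WStar.actX m 𝒜 z.1 ∈ WStar.level m 𝒜 P ((k + 1) / 2) := h2
    refine add_mem ⟨WStar.mul_mem_level hy h1 (by omega), ?_⟩ (Submodule.smul_mem _ _ ⟨h2', ?_⟩)
    · change WStar.actX m 𝒜 (WStar.mul m 𝒜 y.1 z.1) ∈ WStar.level m 𝒜 P _
      rw [WStar.actX_mul]
      exact add_mem (WStar.mul_mem_level (WStar.actX_mem_level hy) h1 (by omega))
        (WStar.mul_mem_level hy h2' (by omega))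
    · change WStar.actX m 𝒜 (WStar.actX m 𝒜 z.1) ∈ WStar.level m 𝒜 P _
      rw [WStar.actX_actX]
      exact zero_mem _

/-- The subalgebra of the elements of `L*` whose component in `W*` is supported on sets that
meet `P`. -/
noncomputable def LStar.meeting (m : ℕ) (𝒜 : SetFamily) (P : Finset ℕ) :
    LieSubalgebra (ZMod 2) (LStar m 𝒜) where
  carrier := {y | y.1 ∈ WStar.level m 𝒜 P 1}
  add_mem' {y z} hy hz := by
    have hy' : y.1 ∈ WStar.level m 𝒜 P 1 := hy
    have hz' : z.1 ∈ WStar.level m 𝒜 P 1 := hz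
    change y.1 + z.1 ∈ WStar.level m 𝒜 P 1
    exact add_mem hy' hz'
  zero_mem' := zero_mem (WStar.level m 𝒜 P 1)
  smul_mem' t y hy := by
    have hy' : y.1 ∈ WStar.level m 𝒜 P 1 := hy
    change t • y.1 ∈ WStar.level m 𝒜 P 1
    exact Submodule.smul_mem _ t hy'
  lie_mem' {y z} hy hz := by
    have hy' : y.1 ∈ WStar.level m 𝒜 P 1 := hy
    have hz' : z.1 ∈ WStar.level m 𝒜 P 1 := hz
    change (⁅y, z⁆ : LStar m 𝒜).1 ∈ WStar.level m 𝒜 P 1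
    rw [LStar.lie_fst]
    exact sub_mem (add_mem (WStar.mul_mem_level hy' hz' (by omega))
      (Submodule.smul_mem _ _ (WStar.actX_mem_level hz')))
      (Submodule.smul_mem _ _ (WStar.actX_mem_level hy'))

theorem LStar.mem_meeting {P : Finset ℕ} {y : LStar m 𝒜} :
    y ∈ LStar.meeting m 𝒜 P ↔ y.1 ∈ WStar.level m 𝒜 P 1 := Iff.rfl

theorem isLieLocallyNilpotent_LStar : IsLieLocallyNilpotent (ZMod 2) (LStar m 𝒜) := by
  intro s hs
  obtain ⟨P, hP⟩ := ((Filter.eventually_all_finite hs).2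
    fun y _ => eventually_mem_level y.1).exists
  have hK : LieSubalgebra.lieSpan (ZMod 2) (LStar m 𝒜) s ≤ LStar.meeting m 𝒜 P :=
    LieSubalgebra.lieSpan_le.2 fun y hy => LStar.mem_meeting.2 (hP y hy)
  generalize LieSubalgebra.lieSpan (ZMod 2) (LStar m 𝒜) s = K at hK
  have key : ∀ k, ∀ y ∈ LieModule.lowerCentralSeries (ZMod 2) K K k,
      (y : LStar m 𝒜) ∈ LStar.chain m 𝒜 P k := by
    intro k
    induction k with
    | zero => exact fun _ _ => Submodule.mem_top
    | succ k ih =>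
      intro y hy
      rw [LieModule.lowerCentralSeries_succ, ← LieSubmodule.mem_toSubmodule,
        LieSubmodule.lieIdeal_oper_eq_linear_span'] at hy
      induction hy using Submodule.span_induction with
      | zero => exact zero_mem _
      | add y z _ _ hy hz => exact add_mem hy hz
      | smul t y _ hy => exact Submodule.smul_mem _ t hy
      | mem y hy =>
        obtain ⟨u, -, z, hz, rfl⟩ := hy
        exact LStar.ad_mem_shiftBy (y := (u : LStar m 𝒜)) (LStar.mem_meeting.1 (hK u.2)) k
          (z : LStar m 𝒜) (ih z hz)
  refine (LieModule.isNilpotent_iff (ZMod 2) K K).2 ⟨2 * (P.card + 1) + 1, ?_⟩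
  rw [eq_bot_iff]
  intro y hy
  have := key _ y hy
  rw [LStar.chain_eq_bot, Submodule.mem_bot] at this
  exact (LieSubmodule.mem_bot _).2 (Subtype.ext this)

/-! ### Local properties of `G` -/

theorem oneAddAd_mem_stabilizer {P : Finset ℕ} {y : LStar m 𝒜} (hy : y.1 ∈ WStar.level m 𝒜 P 1)
    (hy' : LieAlgebra.ad (ZMod 2) (LStar m 𝒜) y * LieAlgebra.ad (ZMod 2) (LStar m 𝒜) y = 0) :
    oneAddAd y hy' ∈ stabilizer (LStar.chain m 𝒜 P) (LStar.chain_anti P) 1 := by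
  have : (oneAddAd y hy' : Module.End (ZMod 2) (LStar m 𝒜)) - 1 ∈
      shiftBy (LStar.chain m 𝒜 P) 1 := by
    rw [oneAddAd_val, add_sub_cancel_left]
    exact LStar.ad_mem_shiftBy hy
  exact ⟨this, this⟩

/-- A generator lies in the stabilizer once `P` meets its index set, with no condition for `1 +
ad(x)`; products and inverses follow because the stabilizers are subgroups. -/
theorem G.eventually_mem_stabilizer {g : LinearMap.GeneralLinearGroup (ZMod 2) (LStar m 𝒜)}
    (hg : g ∈ G m 𝒜) : ∀ᶠ P : Finset ℕ in Filter.atTop,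
      g ∈ stabilizer (LStar.chain m 𝒜 P) (LStar.chain_anti P) 1 := by
  induction hg using Subgroup.closure_induction with
  | mem g hg =>
    rcases hg with (rfl | ⟨p, rfl⟩) | ⟨A, rfl⟩
    · exact (eventually_mem_level _).mono fun P hP => oneAddAd_mem_stabilizer hP _
    · exact (eventually_mem_level _).mono fun P hP => oneAddAd_mem_stabilizer hP _
    · exact (eventually_mem_level _).mono fun P hP => oneAddAd_mem_stabilizer hP _
  | one => exact Filter.Eventually.of_forall fun P => one_mem _
  | mul g h _ _ hg hh =>
    filter_upwards [hg, hh] with P h1 h2 using mul_mem h1 h2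
  | inv g _ hg => exact hg.mono fun P hP => inv_mem hP

theorem isPGroup_G : IsPGroup 2 (G m 𝒜) := by
  intro g
  obtain ⟨P, hP⟩ := (G.eventually_mem_stabilizer g.2).exists
  exact ⟨_, Subtype.ext (pow_eq_one_of_mem_stabilizer _ rfl (LStar.chain_eq_bot P) hP)⟩

theorem G.exists_stabilizer (K : Subgroup (G m 𝒜)) (hK : K.FG) : ∃ P : Finset ℕ, ∀ g ∈ K,
    (g : LinearMap.GeneralLinearGroup (ZMod 2) (LStar m 𝒜)) ∈
      stabilizer (LStar.chain m 𝒜 P) (LStar.chain_anti P) 1 := by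
  obtain ⟨s, rfl⟩ := hK
  obtain ⟨P, hP⟩ := ((Filter.eventually_all_finset s).2
    fun g _ => G.eventually_mem_stabilizer g.2).exists
  refine ⟨P, fun g hg => ?_⟩
  have : Subgroup.closure (s : Set (G m 𝒜)) ≤
      (stabilizer (LStar.chain m 𝒜 P) (LStar.chain_anti P) 1).comap (G m 𝒜).subtype :=
    (Subgroup.closure_le _).2 fun g hg => hP g hg
  exact this hg

theorem isLocallyFinite_G : IsLocallyFinite (G m 𝒜) := by
  intro K hK
  obtain ⟨P, hP⟩ := G.exists_stabilizer K hK
  have : Group.FG K := (Group.fg_iff_subgroup_fg K).2 hK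
  exact finite_of_stabilizer _ rfl (LStar.chain_eq_bot P) ((G m 𝒜).subtype.comp K.subtype)
    (Subtype.val_injective.comp Subtype.val_injective) fun g => hP g g.2

theorem isLocallyNilpotent_G : IsLocallyNilpotent (G m 𝒜) := by
  intro K hK
  obtain ⟨P, hP⟩ := G.exists_stabilizer K hK
  exact isNilpotent_of_stabilizer _ rfl (LStar.chain_eq_bot P) ((G m 𝒜).subtype.comp K.subtype)
    (Subtype.val_injective.comp Subtype.val_injective) fun g => hP g g.2

end Filtration

/-! ### The normal closure -/

section NormalClosure

variable {m : ℕ} {𝒜 : SetFamily}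

/-- The family contains all nonempty finite sets. -/
def HasFinite (𝒜 : SetFamily) : Prop := ∀ s : Finset ℕ, s.Nonempty → (s : Set ℕ) ∈ 𝒜.sets

/-- The element `1 + ad(v(i)_A)` of `G`. -/
noncomputable def G.v (i : Fin (dim m)) (A : 𝒜.sets) : G m 𝒜 :=
  ⟨genV i A, Subgroup.subset_closure (Or.inl (Or.inr ⟨(i, A), rfl⟩))⟩

/-- The element `1 + ad(w_A)` of `G`. -/
noncomputable def G.w (m : ℕ) (A : 𝒜.sets) : G m 𝒜 :=
  ⟨genW A, Subgroup.subset_closure (Or.inr ⟨A, rfl⟩)⟩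

theorem oneAddAd_congr {y z : LStar m 𝒜} (e : y = z)
    (hy : LieAlgebra.ad (ZMod 2) (LStar m 𝒜) y * LieAlgebra.ad (ZMod 2) (LStar m 𝒜) y = 0)
    (hz : LieAlgebra.ad (ZMod 2) (LStar m 𝒜) z * LieAlgebra.ad (ZMod 2) (LStar m 𝒜) z = 0) :
    oneAddAd y hy = oneAddAd z hz := by
  subst e; rfl

theorem commutator_copy {z t u : W m} (e : ⁅z, t⁆ = u) {A B C : 𝒜.sets}
    (h : Disjoint (A : Set ℕ) (B : Set ℕ)) (hC : (A : Set ℕ) ∪ B = C) :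
    oneAddAd (LStar.copy z A) (ad_copy_sq z A) * oneAddAd (LStar.copy t B) (ad_copy_sq t B) *
      (oneAddAd (LStar.copy z A) (ad_copy_sq z A))⁻¹ *
      (oneAddAd (LStar.copy t B) (ad_copy_sq t B))⁻¹ =
    oneAddAd (LStar.copy u C) (ad_copy_sq u C) := by
  have e' : ⁅LStar.copy z A, LStar.copy t B⁆ = LStar.copy u C := by
    rw [LStar.copy_lie_copy z t h, e]
    congr 1
    exact Subtype.ext hC
  rw [(isSandwich_copy z A).commutator (isSandwich_copy t B) _ _ (by rw [e', ad_copy_sq])]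
  exact oneAddAd_congr e' _ _

theorem commutator_x_copy (hm : 2 ≤ m) {z u : W m} (e : ⁅L.x m, z⁆ = u) (A : 𝒜.sets) :
    oneAddAd (LStar.x m 𝒜) (ad_x_sq m 𝒜) * oneAddAd (LStar.copy z A) (ad_copy_sq z A) *
      (oneAddAd (LStar.x m 𝒜) (ad_x_sq m 𝒜))⁻¹ *
      (oneAddAd (LStar.copy z A) (ad_copy_sq z A))⁻¹ =
    oneAddAd (LStar.copy u A) (ad_copy_sq u A) := by
  have e' : ⁅LStar.x m 𝒜, LStar.copy z A⁆ = LStar.copy u A := by rw [LStar.x_lie_copy, e]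
  rw [(isSandwich_x hm).commutator (isSandwich_copy z A) _ _ (by rw [e', ad_copy_sq])]
  exact oneAddAd_congr e' _ _

theorem commutator_mem_of_normal {H : Type*} [Group H] {N : Subgroup H} [hN : N.Normal] {g : H}
    (hg : g ∈ N) (h : H) : g * h * g⁻¹ * h⁻¹ ∈ N := by
  rw [mul_assoc, mul_assoc, ← mul_assoc h]
  exact mul_mem hg (hN.conj_mem _ (inv_mem hg) h)

theorem commutator_a_w (hm : 2 ≤ m) (h : 0 < dim m) (A : 𝒜.sets) :
    G.a m 𝒜 * G.w m A * (G.a m 𝒜)⁻¹ * (G.w m A)⁻¹ = G.v ⟨0, h⟩ A :=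
  Subtype.ext (commutator_x_copy hm (W.x_lie_w h) A)

theorem commutator_v_w_of_lt (i : Fin (dim m)) (hi : (i : ℕ) + 1 < dim m) {A B C : 𝒜.sets}
    (h : Disjoint (A : Set ℕ) (B : Set ℕ)) (hC : (A : Set ℕ) ∪ B = C) :
    G.v i A * G.w m B * (G.v i A)⁻¹ * (G.w m B)⁻¹ = G.v ⟨i + 1, hi⟩ C :=
  Subtype.ext (commutator_copy (W.v_lie_w_of_lt i hi) h hC)

theorem commutator_v_w_of_eq (i : Fin (dim m)) (hi : (i : ℕ) + 1 = dim m) {A B C : 𝒜.sets}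
    (h : Disjoint (A : Set ℕ) (B : Set ℕ)) (hC : (A : Set ℕ) ∪ B = C) :
    G.v i A * G.w m B * (G.v i A)⁻¹ * (G.w m B)⁻¹ = G.w m C :=
  Subtype.ext (commutator_copy (W.v_lie_w_of_eq i hi) h hC)

theorem commutator_w_v_of_eq (i : Fin (dim m)) (hi : (i : ℕ) + 1 = dim m) {A B C : 𝒜.sets}
    (h : Disjoint (A : Set ℕ) (B : Set ℕ)) (hC : (A : Set ℕ) ∪ B = C) :
    G.w m A * G.v i B * (G.w m A)⁻¹ * (G.v i B)⁻¹ = G.w m C :=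
  Subtype.ext (commutator_copy ((W.lie_comm _ _).trans (W.v_lie_w_of_eq i hi)) h hC)

/-- Raising the index by one costs one point of `s`, used as the singleton carrying `w`; this is why
`i < |s|` is needed. -/
theorem v_mem_normalClosure (hm : 2 ≤ m) (h𝒜 : HasFinite 𝒜) (i : ℕ) (hi : i < dim m)
    (s : Finset ℕ) (hs : s.Nonempty) (hcard : i < s.card) :
    G.v ⟨i, hi⟩ ⟨s, h𝒜 s hs⟩ ∈ Subgroup.normalClosure {G.a m 𝒜} := by
  induction i generalizing s with
  | zero =>
    rw [← commutator_a_w hm hi]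
    exact commutator_mem_of_normal (Subgroup.subset_normalClosure (Set.mem_singleton _)) _
  | succ i ih =>
    obtain ⟨c, hc⟩ := hs
    have hcard' := Finset.card_erase_of_mem hc
    have hne : (s.erase c).Nonempty := Finset.card_pos.1 (by omega)
    rw [← commutator_v_w_of_lt ⟨i, by omega⟩ hi (A := ⟨_, h𝒜 _ hne⟩)
      (B := ⟨({c} : Finset ℕ), h𝒜 _ (Finset.singleton_nonempty c)⟩)]
    · exact commutator_mem_of_normal (ih (by omega) _ hne (by omega)) _
    · simp
    · simpa using hc

theorem w_mem_lowerCentralSeries (hm : 2 ≤ m) (h𝒜 : HasFinite 𝒜) (k : ℕ) (s : Finset ℕ)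
    (hs : s.Nonempty) (hcard : dim m * (k + 1) < s.card) :
    G.w m ⟨s, h𝒜 s hs⟩ ∈ (Subgroup.normalClosure {G.a m 𝒜}).lowerCentralSeries k := by
  have hn := two_le_dim hm
  have hlast : dim m - 1 + 1 = dim m := by omega
  induction k generalizing s with
  | zero =>
    obtain ⟨c, hc⟩ := hs
    have hcard' := Finset.card_erase_of_mem hc
    have hne : (s.erase c).Nonempty := Finset.card_pos.1 (by omega)
    rw [← commutator_v_w_of_eq ⟨dim m - 1, by omega⟩ hlast (A := ⟨_, h𝒜 _ hne⟩)
      (B := ⟨({c} : Finset ℕ), h𝒜 _ (Finset.singleton_nonempty c)⟩)]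
    · exact commutator_mem_of_normal
        (v_mem_normalClosure hm h𝒜 _ (by omega) _ hne (by omega)) _
    · simp
    · simpa using hc
  | succ k ih =>
    rw [mul_add, mul_one] at hcard
    -- With `n` points in `t`, the element with index `n - 1` on `t` lies in the normal closure, and
    -- more than `n(k + 1)` points remain for the inductive hypothesis.
    obtain ⟨t, hts, ht⟩ := Finset.exists_subset_card_eq (s := s) (n := dim m) (by omega)
    have hcard' := Finset.card_sdiff_of_subset hts
    have hne : (s \ t).Nonempty := Finset.card_pos.1 (by omega)
    have hnt : t.Nonempty := Finset.card_pos.1 (by omega)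
    rw [← commutator_w_v_of_eq ⟨dim m - 1, by omega⟩ hlast (A := ⟨_, h𝒜 _ hne⟩)
      (B := ⟨_, h𝒜 _ hnt⟩)]
    · exact Subgroup.commutator_mem_commutator (ih _ hne (by omega))
        (v_mem_normalClosure hm h𝒜 _ (by omega) _ hnt (by omega))
    · exact Finset.disjoint_coe.2 Finset.sdiff_disjoint
    · rw [← Finset.coe_union, Finset.sdiff_union_of_subset hts]

theorem not_isNilpotent_normalClosure (hm : 2 ≤ m) (h𝒜 : HasFinite 𝒜) :
    ¬ Group.IsNilpotent (Subgroup.normalClosure {G.a m 𝒜}) := by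
  rw [Subgroup.isNilpotent_iff_lowerCentralSeries]
  rintro ⟨k, hk⟩
  let s := Finset.range (dim m * (k + 1) + 1)
  have hs : s.Nonempty := Finset.nonempty_range_add_one
  have h := w_mem_lowerCentralSeries hm h𝒜 k s hs (by simp [s])
  rw [hk, Subgroup.mem_bot] at h
  have h1 := orderOf_genW hm ⟨s, h𝒜 s hs⟩
  rw [show genW (m := m) ⟨s, h𝒜 s hs⟩ = 1 from congrArg Subtype.val h, orderOf_one] at h1
  exact absurd h1 (by norm_num)

end NormalClosure

end EngelTwo
-- Assembly of the theorem
open EngelTwo in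
theorem theorem3p4 (m : ℕ) (hm : 2 ≤ m) (𝒜 : SetFamily)
    (h𝒜 : 𝒜 = SetFamily.all ∨ 𝒜 = SetFamily.finite) :
    -- `L*` is infinite-dimensional and locally nilpotent
    ¬ Module.Finite (ZMod 2) (LStar m 𝒜) ∧
    IsLieLocallyNilpotent (ZMod 2) (LStar m 𝒜) ∧
    -- the generators of `G` are involutions
    orderOf (genX m 𝒜) = 2 ∧
    (∀ (i : Fin (dim m)) (A : 𝒜.sets),
      (A : Set ℕ) ≠ Set.univ → orderOf (genV i A : (LStar m 𝒜 →ₗ[ZMod 2] LStar m 𝒜)ˣ) = 2) ∧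
    (∀ A : 𝒜.sets, orderOf (genW A : (LStar m 𝒜 →ₗ[ZMod 2] LStar m 𝒜)ˣ) = 2) ∧
    -- `1 + ad(x)` is a left 3-Engel element whose normal closure is not nilpotent
    IsLeftEngel 3 (G.a m 𝒜) ∧
    ¬ Group.IsNilpotent (Subgroup.normalClosure {G.a m 𝒜}) ∧
    -- `G` is a locally finite, locally nilpotent 2-group
    IsLocallyFinite (G m 𝒜) ∧
    IsLocallyNilpotent (G m 𝒜) ∧
    IsPGroup 2 (G m 𝒜) := by
  have hfin : HasFinite 𝒜 := by
    rcases h𝒜 with rfl | rfl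
    · exact fun s hs => hs
    · exact fun s hs => ⟨hs, s.finite_toSet⟩
  let single : ℕ → 𝒜.sets := fun a => ⟨({a} : Finset ℕ), hfin _ (Finset.singleton_nonempty a)⟩
  refine ⟨?_, isLieLocallyNilpotent_LStar, orderOf_genX hm (single 0), ?_, orderOf_genW hm,
    isLeftEngel_a hm, not_isNilpotent_normalClosure hm hfin, isLocallyFinite_G,
    isLocallyNilpotent_G, isPGroup_G⟩
  · intro h
    -- A finite-dimensional space over the field with two elements is finite, but the copies of `w`
    -- on singletons are infinitely many distinct vectors.
    have : Finite (LStar m 𝒜) := Module.finite_of_finite (ZMod 2)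
    refine not_injective_infinite_finite (fun a => LStar.copy (W.w m) (single a)) fun a b e => ?_
    have h1 := (Finsupp.single_left_inj W.w_ne_zero).1 (congrArg Prod.fst e)
    simpa [single] using h1
  · intro i A hA
    -- A point outside `A` gives the disjoint singleton on which `v(i)_A` acts nontrivially.
    obtain ⟨a, ha⟩ := (Set.ne_univ_iff_exists_notMem _).1 hA
    refine orderOf_genV i (B := single a) ?_
    simpa [single] using ha
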